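/- A rooted map is a proper embedding of a finite connected graph (loops and multiple edges allowed) with at least one edge into the two-dimensional sphere, considered up to orientation-preserving homeomorphism (continuous deformation), together with a distinguished oriented edge, called the root. The face on the right of the root is the root-face; the other faces are internal. A vertex is external if it is incident to the root-face and internal otherwise. The degree of a face is the number of edge-sides on its boundary, and the degree of a vertex is the number of half-edges at it. A map is a near-triangulation if all its internal faces have degree $3$, and it is non-separable if it has no loop and the deletion of any one vertex does not disconnect it. (In particular, the map consisting of a single edge joining two vertices is a non-separable near-triangulation, with root-face of degree $2$.) Let $\mathbf{T}$ be the set of non-separable rooted near-triangulations in which every internal vertex has degree at least $3$. For $n,d\ge 0$ let $a_{n,d}$ be the number of maps in $\mathbf{T}$ with $n$ edges and root-face of degree $d+2$, and let $$\mathbb{T}(x)=\mathbb{T}(x,z)=\sum_{n,d\ge 0} a_{n,d}\,x^d z^n ,$$ a formal power series in $z$ whose coefficients are polynomials in $x$. Write $\mathbb{T}(0)=\mathbb{T}(0,z)$. Proposition. The generating function $\mathbb{T}(x)$ satisfies $$\mathbb{T}(x)=z+xz\,\mathbb{T}(x)^2+z\left(\frac{\mathbb{T}(x)-\mathbb{T}(0)}{x}\right)-z^3\,\mathbb{T}(x).$$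 -/

import Mathlib

/-- A rooted planar map, encoded by its rotation system on the finite set `D` of darts
(half-edges; equivalently, oriented edges).

* `σ` sends a dart to the next dart in counterclockwise order around its origin, so that the
  vertices are the cycles of `σ`;
* `α` reverses a dart, so that the edges are the (two-element) cycles of `α`;
* `σ * α` (first `α`, then `σ`) sends a dart to the next dart along the boundary of the face on
  its right, so that the faces are the cycles of `σ * α`;
* the map is connected, and it is drawn on the sphere, which is expressed by Euler's relation
  `V + F = E + 2`;
* the root is an oriented edge, that is, a dart. -/
structure RootedMap (D : Type*) where
  σ : Equiv.Perm D
  α : Equiv.Perm D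
  root : D
  α_invol : ∀ d, α (α d) = d
  α_ne : ∀ d, α d ≠ d
  connected : ∀ a b, ∃ g ∈ Subgroup.closure {σ, α}, g a = b
  euler : Nat.card (Quotient (Equiv.Perm.SameCycle.setoid σ))
      + Nat.card (Quotient (Equiv.Perm.SameCycle.setoid (σ * α)))
      = Nat.card (Quotient (Equiv.Perm.SameCycle.setoid α)) + 2

namespace RootedMap

variable {D D' : Type*}

/-- The vertices of a map. -/
def Vertex (M : RootedMap D) : Type _ := Quotient (Equiv.Perm.SameCycle.setoid M.σ)

/-- The faces of a map. -/
def Face (M : RootedMap D) : Type _ := Quotient (Equiv.Perm.SameCycle.setoid (M.σ * M.α))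

/-- The origin of a dart. The end of `d` is `M.origin (M.α d)`. -/
def origin (M : RootedMap D) (d : D) : M.Vertex := Quotient.mk _ d

/-- The face on the right of a dart. -/
def rightFace (M : RootedMap D) (d : D) : M.Face := Quotient.mk _ d

/-- The degree of a vertex: the number of darts leaving it (a loop would count twice). -/
noncomputable def vertexDegree (M : RootedMap D) (v : M.Vertex) : ℕ :=
  Nat.card {d : D // M.origin d = v}

/-- The degree of a face: the number of darts with this face on their right
(an edge with the face on both sides counts twice). -/
noncomputable def faceDegree (M : RootedMap D) (f : M.Face) : ℕ :=
  Nat.card {d : D // M.rightFace d = f}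

/-- The root-face is the face on the right of the root. All other faces are internal. -/
def rootFace (M : RootedMap D) : M.Face := M.rightFace M.root

/-- A vertex is external if it is incident to the root-face, and internal otherwise. -/
def IsExternal (M : RootedMap D) (v : M.Vertex) : Prop :=
  ∃ d : D, M.rightFace d = M.rootFace ∧ M.origin d = v

/-- All internal faces have degree 3. -/
def IsNearTriangulation (M : RootedMap D) : Prop :=
  ∀ f : M.Face, f ≠ M.rootFace → M.faceDegree f = 3

/-- No edge is a loop. -/
def Loopless (M : RootedMap D) : Prop :=
  ∀ d : D, M.origin (M.α d) ≠ M.origin d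

/-- The adjacency relation between distinct vertices of the underlying graph. -/
def graph (M : RootedMap D) : SimpleGraph M.Vertex where
  Adj u v := u ≠ v ∧ ∃ d : D, M.origin d = u ∧ M.origin (M.α d) = v
  symm := ⟨by
    rintro u v ⟨h, d, hu, hv⟩
    exact ⟨h.symm, M.α d, hv, by rw [M.α_invol]; exact hu⟩⟩
  loopless := ⟨fun _ h => h.1 rfl⟩

/-- A map is non-separable if it has no loop and the deletion of a vertex never disconnects it. -/
def IsNonSeparable (M : RootedMap D) : Prop :=
  M.Loopless ∧ ∀ v : M.Vertex, (M.graph.induce {v}ᶜ).Preconnected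

/-- Membership in the class `T`: non-separable near-triangulations all of whose internal vertices
have degree at least 3. -/
def IsT (M : RootedMap D) : Prop :=
  M.IsNonSeparable ∧ M.IsNearTriangulation ∧
    ∀ v : M.Vertex, ¬ M.IsExternal v → 3 ≤ M.vertexDegree v

/-- Isomorphism of rooted maps (homeomorphic equivalence preserving orientation and root). -/
def Iso (M : RootedMap D) (N : RootedMap D') : Prop :=
  ∃ e : D ≃ D', (∀ d, e (M.σ d) = N.σ (e d)) ∧ (∀ d, e (M.α d) = N.α (e d)) ∧ e M.root = N.root

/-- Isomorphism as an equivalence relation on the maps with a given set of darts. -/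
def isoSetoid (D : Type*) : Setoid (RootedMap D) where
  r M N := M.Iso N
  iseqv :=
    { refl := fun _ => ⟨Equiv.refl _, fun _ => rfl, fun _ => rfl, rfl⟩
      symm := by
        rintro M N ⟨e, h1, h2, h3⟩
        refine ⟨e.symm, fun d => ?_, fun d => ?_, ?_⟩
        · rw [Equiv.symm_apply_eq, h1, Equiv.apply_symm_apply]
        · rw [Equiv.symm_apply_eq, h2, Equiv.apply_symm_apply]
        · rw [Equiv.symm_apply_eq, h3]
      trans := by
        rintro M N P ⟨e, h1, h2, h3⟩ ⟨f, g1, g2, g3⟩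
        exact ⟨e.trans f, fun d => by simp [h1, g1], fun d => by simp [h2, g2],
          by simp [h3, g3]⟩ }

end RootedMap

/-- The number of maps in the class `T`, up to isomorphism, with `n` edges (that is, `2 * n` darts)
and root-face of degree `d + 2`. -/
noncomputable def countT (n d : ℕ) : ℕ :=
  Nat.card (Quotient ((RootedMap.isoSetoid (Fin (2 * n))).comap
    (Subtype.val : {M : RootedMap (Fin (2 * n)) //
      M.IsT ∧ M.faceDegree M.rootFace = d + 2} → RootedMap (Fin (2 * n)))))

/-- The generating function `∑ countT n d * x ^ d * z ^ n`, a power series in `z` whose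
coefficients are polynomials in `x` (the bound on `d` loses nothing, see `coeff_coeff_seriesT`). -/
noncomputable def seriesT : PowerSeries (Polynomial ℤ) :=
  PowerSeries.mk fun n => ∑ d ∈ Finset.range (2 * n), Polynomial.monomial d (countT n d : ℤ)

theorem countT_eq_zero {n d : ℕ} (h : 2 * n ≤ d) : countT n d = 0 := by
  have : IsEmpty {M : RootedMap (Fin (2 * n)) //
      M.IsT ∧ M.faceDegree M.rootFace = d + 2} := by
    refine ⟨fun ⟨M, _, hM⟩ => ?_⟩
    have h1 : M.faceDegree M.rootFace ≤ Nat.card (Fin (2 * n)) :=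
      Nat.card_le_card_of_injective _ Subtype.val_injective
    rw [Nat.card_eq_fintype_card, Fintype.card_fin] at h1
    omega
  unfold countT
  rw [Nat.card_eq_zero]
  exact Or.inl ⟨fun q => this.elim (Quotient.exists_rep q).choose⟩

theorem coeff_coeff_seriesT (n d : ℕ) :
    (PowerSeries.coeff n seriesT).coeff d = (countT n d : ℤ) := by
  simp only [seriesT, PowerSeries.coeff_mk, Polynomial.finsetSum_coeff,
    Polynomial.coeff_monomial, Finset.sum_ite_eq', Finset.mem_range]
  split_ifs with h
  · rfl
  · rw [countT_eq_zero (not_lt.mp h), Nat.cast_zero]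

/-- `F(0, z)`, for a power series `F(x, z)` in `z` with polynomial coefficients in `x`. -/
noncomputable def atZero (F : PowerSeries (Polynomial ℤ)) : PowerSeries (Polynomial ℤ) :=
  PowerSeries.mk fun n => Polynomial.C ((PowerSeries.coeff n F).eval 0)

/-! Delete the root edge of a map of the class. Unless the map is a single edge (the term `z`), the
face on the left of the root is internal, hence a triangle; let `v` be its third vertex. If `v` is
external, it is a cut vertex of what remains, which is then two maps of the class glued at `v`: this
gives `x z T ^ 2`. If `v` is internal, what remains is again in the class, its root-face has one
more side, and the deleted edge can be put back in one way only.

This would give `z (T - T(0)) / x`, but an internal `v` must have degree at least 3, so maps with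
root-face of degree at least 3 in which the root ends at a vertex of degree 2 have to be removed.
Rerooting such a map at the next dart of its root-face shows that it comes from an arbitrary map of
the class by gluing a single edge to it and closing a triangle. The removed maps thus have series `x
z ^ 2 T`, and closing turns this into the correction `z ^ 3 T`.

No topology is available besides Euler's relation. Its substitute is `genus_bound`, proved by
multiplying by transpositions one at a time. It yields the Jordan curve property `not_conn_cut`,
whence a face of a nonseparable map visits a vertex at most once (`IsTD.eq_of_sameCycle`). Adding
the edge back is `close`, gluing is `wedge`, and both are built from transpositions, so that their
vertices and faces can be counted. `exists_close` and `exists_wedge` invert them; `IsTD.close`,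
`IsTD.of_close`, `IsTD.close_wedge` and `IsTD.of_close_wedge` show that the class is respected in
both directions. All of this is assembled in `TClass.decomposition_bijective` and
`TClass.exists_equiv_not_good`.

Connectedness and nonseparability are handled throughout by predicates on darts that are invariant
under the permutations: connected means that every such predicate is constant. -/

/-! ### Permutations: cycles, products with a transposition, and the genus bound -/

namespace MapEnum

open Equiv (Perm)
open Equiv.Perm

variable {D D' : Type*}

/-- Classical transposition, to avoid decidability instances. -/
noncomputable def sw (a b : D) : Perm D := @Equiv.swap D (Classical.decEq D) a b

@[simp] theorem sw_left (a b : D) : sw a b a = b := by simp [sw]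
@[simp] theorem sw_right (a b : D) : sw a b b = a := by simp [sw]
theorem sw_of_ne {a b x : D} (h1 : x ≠ a) (h2 : x ≠ b) : sw a b x = x := by
  unfold sw
  exact @Equiv.swap_apply_of_ne_of_ne _ (Classical.decEq D) _ _ _ h1 h2
@[simp] theorem sw_sw (a b x : D) : sw a b (sw a b x) = x := by simp [sw]
@[simp] theorem sw_mul_sw_mul (a b : D) (f : Perm D) : sw a b * (sw a b * f) = f := by
  ext x; simp
theorem sw_cases (a b x : D) : (x = a ∧ sw a b x = b) ∨ (x = b ∧ sw a b x = a) ∨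
    (x ≠ a ∧ x ≠ b ∧ sw a b x = x) := by
  by_cases h1 : x = a
  · subst h1; simp
  · by_cases h2 : x = b
    · subst h2; simp
    · exact Or.inr (Or.inr ⟨h1, h2, sw_of_ne h1 h2⟩)
theorem sw_pred {a b : D} {S : D → Prop} (h : S a ↔ S b) (x : D) : S (sw a b x) ↔ S x := by
  rcases sw_cases a b x with ⟨rfl, h1⟩ | ⟨rfl, h1⟩ | ⟨_, _, h1⟩
  · rw [h1, h]
  · rw [h1, h]
  · rw [h1]
theorem sw_map {a b : D} (e : D ≃ D') (x : D) : e (sw a b x) = sw (e a) (e b) (e x) := by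
  rcases sw_cases a b x with ⟨rfl, h1⟩ | ⟨rfl, h1⟩ | ⟨h2, h3, h1⟩
  · rw [h1, sw_left]
  · rw [h1, sw_right]
  · rw [h1, sw_of_ne (e.injective.ne h2) (e.injective.ne h3)]

/-- The number of cycles, fixed points included. -/
noncomputable def cyc (f : Perm D) : ℕ := Nat.card (Quotient (SameCycle.setoid f))

theorem SameCycle.pred_iff {f : Perm D} {S : D → Prop} (h : ∀ x, S (f x) ↔ S x) {x y : D}
    (hxy : f.SameCycle x y) : S x ↔ S y := by
  obtain ⟨n, rfl⟩ := hxy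
  have key : ∀ n : ℕ, ∀ x, S ((f ^ n) x) ↔ S x := by
    intro n
    induction n with
    | zero => simp
    | succ k ih => intro x; rw [pow_succ', Perm.mul_apply, h, ih]
  cases n with
  | ofNat n => exact (key n x).symm
  | negSucc n =>
    rw [zpow_negSucc]
    conv_lhs => rw [show x = (f ^ (n + 1)) ((f ^ (n + 1))⁻¹ x) by simp]
    rw [key]

theorem SameCycle.pred_of_closed [Finite D] {f : Perm D} {S : D → Prop}
    (h : ∀ x, S x → S (f x)) {x y : D} (hxy : f.SameCycle x y) (hx : S x) : S y := by
  obtain ⟨n, rfl⟩ := hxy.exists_nat_pow_eq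
  induction n with
  | zero => simpa
  | succ k ih => rw [pow_succ', Perm.mul_apply]; exact h _ (ih ⟨k, by simp⟩)

theorem sameCycle_map {f : Perm D} {g : Perm D'} (e : D ≃ D') (h : ∀ x, e (f x) = g (e x))
    (x y : D) : f.SameCycle x y ↔ g.SameCycle (e x) (e y) := by
  constructor
  · intro hxy
    exact (SameCycle.pred_iff (S := fun z => g.SameCycle (e x) (e z))
      (fun z => by rw [h, sameCycle_apply_right]) hxy).1 (SameCycle.refl _ _)
  · intro hxy
    have := (SameCycle.pred_iff (f := g) (S := fun z => f.SameCycle x (e.symm z))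
      (fun z => by
        have : e.symm (g z) = f (e.symm z) := by rw [e.symm_apply_eq, h, e.apply_symm_apply]
        rw [this, sameCycle_apply_right]) hxy).1
    simpa [SameCycle.refl] using this

theorem card_quotient_eq_of_equiv {s : Setoid D} {t : Setoid D'} (e : D ≃ D')
    (h : ∀ x y, s x y ↔ t (e x) (e y)) : Nat.card (Quotient s) = Nat.card (Quotient t) :=
  Nat.card_congr (Quotient.congr e h)

theorem cyc_map {f : Perm D} {g : Perm D'} (e : D ≃ D') (h : ∀ x, e (f x) = g (e x)) :
    cyc f = cyc g :=
  card_quotient_eq_of_equiv e (sameCycle_map e h)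

theorem cyc_mul_comm (f g : Perm D) : cyc (f * g) = cyc (g * f) :=
  cyc_map g (fun x => by simp)

theorem cyc_one : cyc (1 : Perm D) = Nat.card D := by
  refine (Nat.card_congr (Equiv.ofBijective (Quotient.mk _) ⟨fun x y h => ?_, Quot.mk_surjective⟩)).symm
  exact sameCycle_one.1 (Quotient.exact h)

/-- Merging two classes of an equivalence relation lowers the number of classes by one. -/
theorem card_quotient_merge [Finite D] {s t : Setoid D} {a b : D} (hab : ¬ s a b)
    (h : ∀ x y, t x y ↔ s x y ∨ ((s a x ∨ s b x) ∧ (s a y ∨ s b y))) :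
    Nat.card (Quotient s) = Nat.card (Quotient t) + 1 := by
  classical
  have hst : ∀ x y, s x y → t x y := fun x y hxy => (h x y).2 (Or.inl hxy)
  let B : Quotient s := Quotient.mk s b
  -- Every class of `t` contains exactly one class of `s` other than that of `b`.
  let g : {c : Quotient s // c ≠ B} → Quotient t := fun c => Quotient.map' id hst c.1
  have hg : Function.Bijective g := by
    constructor
    · rintro ⟨c, hc⟩ ⟨d, hd⟩ hcd
      induction c using Quotient.inductionOn with | _ x
      induction d using Quotient.inductionOn with | _ y
      have hx : ¬ s b x := fun hx => hc (Quotient.sound (s.symm hx))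
      have hy : ¬ s b y := fun hx => hd (Quotient.sound (s.symm hx))
      have h1 : t x y := Quotient.exact hcd
      rw [h] at h1
      apply Subtype.ext
      apply Quotient.sound
      rcases h1 with h1 | ⟨h1 | h1, h2 | h2⟩
      · exact h1
      · exact s.trans (s.symm h1) h2
      all_goals tauto
    · intro c
      induction c using Quotient.inductionOn with | _ x
      by_cases hx : s b x
      · refine ⟨⟨Quotient.mk s a, fun h' => hab (Quotient.exact h')⟩, ?_⟩
        apply Quotient.sound
        exact (h a x).2 (Or.inr ⟨Or.inl (s.refl a), Or.inr hx⟩)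
      · exact ⟨⟨Quotient.mk s x, fun h' => hx (s.symm (Quotient.exact h'))⟩, rfl⟩
  rw [← Nat.card_congr (Equiv.ofBijective g hg)]
  have := Nat.card_congr (Equiv.optionSubtypeNe B)
  rw [← this, Finite.card_option]

/-! ### Multiplying by a transposition merges two cycles or splits one -/

section Transposition

variable [Finite D] {f : Perm D} {a b : D}

/-- Starting from `a`, the new permutation moves exactly as `f` until the `f`-orbit closes up, since
that orbit avoids `b`. Its last point `f⁻¹ a` is then sent to `b` instead of `a`. -/
theorem sameCycle_sw_mul_self (h : ¬ f.SameCycle a b) : (sw a b * f).SameCycle a b := by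
  set g := sw a b * f with hg
  have key : ∀ k : ℕ, g.SameCycle a ((f ^ k) a) := by
    intro k
    induction k with
    | zero => exact SameCycle.refl _ _
    | succ k ih =>
      have h1 : g ((f ^ k) a) = sw a b ((f ^ (k + 1)) a) := by
        rw [hg, pow_succ', Perm.mul_apply, Perm.mul_apply]
      rcases sw_cases a b ((f ^ (k + 1)) a) with ⟨h2, _⟩ | ⟨h2, _⟩ | ⟨_, _, h2⟩
      · rw [h2]
      · exact absurd ⟨(k + 1 : ℕ), by rw [zpow_natCast]; exact h2⟩ h
      · rw [h2] at h1
        rw [← h1, sameCycle_apply_right]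
        exact ih
  have h2 : f.SameCycle a (f⁻¹ a) := ⟨-1, by simp⟩
  obtain ⟨k, hk⟩ := h2.exists_nat_pow_eq
  have h3 := key k
  rw [hk, ← sameCycle_apply_right] at h3
  simpa [hg] using h3

theorem sameCycle_sw_mul (h : ¬ f.SameCycle a b) (x y : D) :
    (sw a b * f).SameCycle x y ↔ f.SameCycle x y ∨
      ((f.SameCycle a x ∨ f.SameCycle b x) ∧ (f.SameCycle a y ∨ f.SameCycle b y)) := by
  set g := sw a b * f with hg
  have hab : g.SameCycle a b := sameCycle_sw_mul_self h
  have hfg : ∀ x y, f.SameCycle x y → g.SameCycle x y := by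
    intro x y hxy
    refine (SameCycle.pred_iff (S := fun z => g.SameCycle x z) (fun z => ?_) hxy).1
      (SameCycle.refl _ _)
    rw [← sameCycle_apply_right (f := g) (y := z)]
    refine (sw_pred (a := a) (b := b) (S := fun z => g.SameCycle x z) ⟨?_, ?_⟩ _).symm
    · exact fun h1 => h1.trans hab
    · exact fun h1 => h1.trans hab.symm
  constructor
  · intro hxy
    refine (SameCycle.pred_iff (S := fun z => f.SameCycle x z ∨
      ((f.SameCycle a x ∨ f.SameCycle b x) ∧ (f.SameCycle a z ∨ f.SameCycle b z)))
      (fun z => ?_) hxy).1 (Or.inl (SameCycle.refl _ _))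
    rw [hg, Perm.mul_apply, sw_pred (S := fun z => f.SameCycle x z ∨
      ((f.SameCycle a x ∨ f.SameCycle b x) ∧ (f.SameCycle a z ∨ f.SameCycle b z)))]
    · simp only [sameCycle_apply_right]
    · have e1 := sameCycle_comm (f := f) (x := x) (y := a)
      have e2 := sameCycle_comm (f := f) (x := x) (y := b)
      have := SameCycle.refl f a
      have := SameCycle.refl f b
      tauto
  · rintro (h1 | ⟨h1 | h1, h2 | h2⟩)
    · exact hfg _ _ h1
    · exact hfg _ _ (h1.symm.trans h2)
    · exact (hfg _ _ h1.symm).trans (hab.trans (hfg _ _ h2))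
    · exact (hfg _ _ h1.symm).trans (hab.symm.trans (hfg _ _ h2))
    · exact hfg _ _ (h1.symm.trans h2)

theorem not_sameCycle_sw_mul (h : f.SameCycle a b) (hab : a ≠ b) :
    ¬ (sw a b * f).SameCycle a b := by
  classical
  have hex : ∃ k : ℕ, (f ^ k) a = b := h.exists_nat_pow_eq
  set k := Nat.find hex with hk
  have hkb : (f ^ k) a = b := Nat.find_spec hex
  have hmin : ∀ j < k, (f ^ j) a ≠ b := fun j hj => Nat.find_min hex hj
  have hk0 : 0 < k := by
    rcases Nat.eq_zero_or_pos k with h0 | h0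
    · rw [h0] at hkb; exact absurd (by simpa using hkb) hab
    · exact h0
  intro hg
  -- The arc from `a` up to just before the first visit to `b` is closed under `sw a b * f`: its
  -- last point would go to `b`, which the transposition replaces by `a`.
  have := SameCycle.pred_of_closed (S := fun z => ∃ j < k, (f ^ j) a = z) ?_ hg ⟨0, hk0, rfl⟩
  · obtain ⟨j, hj, hj'⟩ := this
    exact hmin j hj hj'
  · rintro _ ⟨j, hj, rfl⟩
    have h1 : (sw a b * f) ((f ^ j) a) = sw a b ((f ^ (j + 1)) a) := by
      rw [pow_succ', Perm.mul_apply, Perm.mul_apply]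
    rcases Nat.lt_or_ge (j + 1) k with h2 | h2
    · refine ⟨j + 1, h2, ?_⟩
      rw [h1, sw_of_ne _ (hmin _ h2)]
      intro h3
      apply hmin (k - (j + 1)) (by omega)
      have h4 : (f ^ (k - (j + 1))) ((f ^ (j + 1)) a) = b := by
        rw [← Perm.mul_apply, ← pow_add, Nat.sub_add_cancel h2.le, hkb]
      rwa [h3] at h4
    · have h3 : j + 1 = k := by omega
      refine ⟨0, hk0, ?_⟩
      rw [h1, h3, hkb]; simp

theorem cyc_sw_mul_of_not_sameCycle (h : ¬ f.SameCycle a b) : cyc f = cyc (sw a b * f) + 1 :=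
  card_quotient_merge (s := SameCycle.setoid f) (t := SameCycle.setoid (sw a b * f)) h
    (sameCycle_sw_mul h)

theorem cyc_sw_mul_of_sameCycle (h : f.SameCycle a b) (hab : a ≠ b) :
    cyc (sw a b * f) = cyc f + 1 := by
  have := cyc_sw_mul_of_not_sameCycle (not_sameCycle_sw_mul h hab)
  rwa [sw_mul_sw_mul] at this

end Transposition

/-! ### Permutations of a disjoint union -/

section Sum

variable (f : Perm D) (g : Perm D')

theorem sameCycle_inl_inl (x y : D) :
    (sumCongr f g).SameCycle (Sum.inl x) (Sum.inl y) ↔ f.SameCycle x y := by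
  constructor
  · intro h
    exact (SameCycle.pred_iff (f := sumCongr f g)
      (S := fun z => Sum.elim (fun z => f.SameCycle x z) (fun _ => False) z)
      (by rintro (z | z) <;> simp) h).1 (SameCycle.refl f x)
  · intro h
    exact (SameCycle.pred_iff (f := f) (S := fun z => (sumCongr f g).SameCycle (Sum.inl x) (Sum.inl z))
      (fun z => by
        rw [← sameCycle_apply_right (f := sumCongr f g) (y := Sum.inl z)]; simp) h).1
      (SameCycle.refl _ _)

theorem sameCycle_inr_inr (x y : D') :
    (sumCongr f g).SameCycle (Sum.inr x) (Sum.inr y) ↔ g.SameCycle x y := by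
  constructor
  · intro h
    exact (SameCycle.pred_iff (f := sumCongr f g)
      (S := fun z => Sum.elim (fun _ => False) (fun z => g.SameCycle x z) z)
      (by rintro (z | z) <;> simp) h).1 (SameCycle.refl g x)
  · intro h
    exact (SameCycle.pred_iff (f := g) (S := fun z => (sumCongr f g).SameCycle (Sum.inr x) (Sum.inr z))
      (fun z => by
        rw [← sameCycle_apply_right (f := sumCongr f g) (y := Sum.inr z)]; simp) h).1
      (SameCycle.refl _ _)

theorem not_sameCycle_inl_inr (x : D) (y : D') :
    ¬ (sumCongr f g).SameCycle (Sum.inl x) (Sum.inr y) := by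
  intro h
  exact (SameCycle.pred_iff (f := sumCongr f g)
      (S := fun z => Sum.elim (fun _ => True) (fun _ => False) z)
      (by rintro (z | z) <;> simp) h).1 trivial

theorem not_sameCycle_inr_inl (x : D) (y : D') :
    ¬ (sumCongr f g).SameCycle (Sum.inr y) (Sum.inl x) :=
  fun h => not_sameCycle_inl_inr f g x y h.symm

theorem cyc_sumCongr [Finite D] [Finite D'] : cyc (sumCongr f g) = cyc f + cyc g := by
  unfold cyc
  rw [← Nat.card_sum]
  let F : Quotient (SameCycle.setoid f) ⊕ Quotient (SameCycle.setoid g) →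
      Quotient (SameCycle.setoid (sumCongr f g)) :=
    Sum.elim (Quotient.map' Sum.inl fun x y h => (sameCycle_inl_inl f g x y).2 h)
      (Quotient.map' Sum.inr fun x y h => (sameCycle_inr_inr f g x y).2 h)
  refine (Nat.card_congr (Equiv.ofBijective F ⟨?_, ?_⟩)).symm
  · rintro (c | c) (d | d) h
    all_goals
      induction c using Quotient.inductionOn with | _ x
      induction d using Quotient.inductionOn with | _ y
      have h' := Quotient.exact h
    · exact congrArg Sum.inl (Quotient.sound ((sameCycle_inl_inl f g x y).1 h'))
    · exact absurd h' (not_sameCycle_inl_inr f g x y)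
    · exact absurd h' (not_sameCycle_inr_inl f g y x)
    · exact congrArg Sum.inr (Quotient.sound ((sameCycle_inr_inr f g x y).1 h'))
  · intro c
    induction c using Quotient.inductionOn with | _ x
    rcases x with x | x
    · exact ⟨Sum.inl (Quotient.mk _ x), rfl⟩
    · exact ⟨Sum.inr (Quotient.mk _ x), rfl⟩

/-- A permutation of a sum that fixes the set of left elements is a sum of permutations. -/
theorem exists_sumCongr_of_mapsTo [Finite D] [Finite D'] (h : Perm (D ⊕ D'))
    (hl : ∀ x, ∃ y, h (Sum.inl x) = Sum.inl y) :
    ∃ (f : Perm D) (g : Perm D'), h = sumCongr f g := by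
  have := mem_sumCongrHom_range_of_perm_mapsTo_inl (σ := h) (by
    rintro _ ⟨x, rfl⟩
    obtain ⟨y, hy⟩ := hl x
    exact ⟨y, hy.symm⟩)
  obtain ⟨⟨f, g⟩, hfg⟩ := this
  exact ⟨f, g, hfg.symm⟩

end Sum

/-! ### Components -/

/-- Two darts are connected if no predicate invariant under both permutations separates them. -/
def conn (σ α : Perm D) : Setoid D where
  r x y := ∀ S : D → Prop, (∀ z, S (σ z) ↔ S z) → (∀ z, S (α z) ↔ S z) → (S x ↔ S y)
  iseqv :=
    { refl := fun _ _ _ _ => Iff.rfl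
      symm := fun h S h1 h2 => (h S h1 h2).symm
      trans := fun h h' S h1 h2 => (h S h1 h2).trans (h' S h1 h2) }

theorem conn_left (σ α : Perm D) (x y : D) : conn σ α x (σ y) ↔ conn σ α x y :=
  ⟨fun h S h1 h2 => (h S h1 h2).trans (h1 y), fun h S h1 h2 => (h S h1 h2).trans (h1 y).symm⟩

theorem conn_right (σ α : Perm D) (x y : D) : conn σ α x (α y) ↔ conn σ α x y :=
  ⟨fun h S h1 h2 => (h S h1 h2).trans (h2 y), fun h S h1 h2 => (h S h1 h2).trans (h2 y).symm⟩

theorem card_conn_eq_one {σ α : Perm D} [Nonempty D] (h : ∀ x y, conn σ α x y) :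
    Nat.card (Quotient (conn σ α)) = 1 := by
  rw [Nat.card_eq_one_iff_unique]
  refine ⟨⟨fun c d => ?_⟩, ‹Nonempty D›.map (Quotient.mk _)⟩
  induction c using Quotient.inductionOn with | _ x
  induction d using Quotient.inductionOn with | _ y
  exact Quotient.sound (h x y)

/-- The genus of a (possibly disconnected) hypermap is nonnegative. -/
theorem genus_bound [Finite D] (σ α : Perm D) :
    cyc σ + cyc α + cyc (α * σ) ≤ Nat.card D + 2 * Nat.card (Quotient (conn σ α)) := by
  classical
  have := Fintype.ofFinite D
  induction hn : α.support.card using Nat.strong_induction_on generalizing α with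
  | _ n ih =>
    by_cases h1 : α = 1
    · subst h1
      have : Nat.card (Quotient (conn σ 1)) = cyc σ := by
        refine card_quotient_eq_of_equiv (Equiv.refl D) fun x y => ⟨fun h => ?_, fun h S h1 _ => ?_⟩
        · exact (h (fun z => σ.SameCycle x z) (fun z => by simp) (fun z => by simp)).1
            (SameCycle.refl _ _)
        · exact SameCycle.pred_iff h1 h
      rw [this, cyc_one, one_mul]
      omega
    · obtain ⟨a, ha⟩ : ∃ a, α a ≠ a := by
        by_contra! h; exact h1 (Equiv.ext h)
      set b := α a with hb
      -- `β` fixes `a`, so its support is smaller and it has one cycle more than `α`.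
      set β := sw a b * α with hβ
      have hcard : β.support.card < n := by
        rw [← hn]
        have := card_support_swap_mul (f := α) ha
        have hsw : sw a b = Equiv.swap a (α a) := by unfold sw; congr!
        rwa [hβ, hsw]
      have hαβ : α = sw a b * β := by rw [hβ, sw_mul_sw_mul]
      have IH := ih _ hcard β rfl
      have hc : cyc β = cyc α + 1 :=
        cyc_sw_mul_of_sameCycle (by rw [hb, sameCycle_apply_right]) (Ne.symm ha)
      have hασ : α * σ = sw a b * (β * σ) := by rw [← mul_assoc, ← hαβ]
      have hβa : β a = a := by simp [hβ, hb]
      -- If `a` and `b` are already connected, the components do not change, and the cycle lost by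
      -- `α` pays for the one that `α * σ` may gain. Otherwise `α` and `α * σ` each lose a cycle and
      -- one component disappears, so both sides drop by 2.
      by_cases hab : conn σ β a b
      · have hk : Nat.card (Quotient (conn σ α)) = Nat.card (Quotient (conn σ β)) := by
          refine card_quotient_eq_of_equiv (Equiv.refl D) fun x y => ⟨fun h S h1 h2 => ?_, fun h S h1 h2 => ?_⟩
          · refine h S h1 fun z => ?_
            rw [hαβ, Perm.mul_apply, sw_pred (hab S h1 h2), h2]
          · refine h S h1 fun z => ?_
            rw [hβ, Perm.mul_apply, sw_pred (h2 a).symm, h2]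
        have : cyc (α * σ) ≤ cyc (β * σ) + 1 := by
          rw [hασ]
          by_cases h2 : (β * σ).SameCycle a b
          · rw [cyc_sw_mul_of_sameCycle h2 (Ne.symm ha)]
          · have := cyc_sw_mul_of_not_sameCycle h2
            omega
        omega
      · have hk : Nat.card (Quotient (conn σ β)) = Nat.card (Quotient (conn σ α)) + 1 := by
          refine card_quotient_merge hab fun x y => ⟨fun h => ?_, fun h => ?_⟩
          · refine (h (fun z => conn σ β x z ∨
              ((conn σ β a x ∨ conn σ β b x) ∧ (conn σ β a z ∨ conn σ β b z))) ?_ ?_).1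
              (Or.inl ((conn σ β).refl x))
            · intro z; simp only [conn_left]
            · intro z
              rw [hαβ, Perm.mul_apply, sw_pred (S := fun z => conn σ β x z ∨
                ((conn σ β a x ∨ conn σ β b x) ∧ (conn σ β a z ∨ conn σ β b z)))]
              · simp only [conn_right]
              · have e1 := (conn σ β).comm' (x := x) (y := a)
                have e2 := (conn σ β).comm' (x := x) (y := b)
                have := (conn σ β).refl a
                have := (conn σ β).refl b
                tauto
          · have hle : ∀ x y, conn σ β x y → conn σ α x y := by
              intro x y h S h1 h2
              refine h S h1 fun z => ?_
              rw [hβ, Perm.mul_apply, sw_pred (h2 a).symm, h2]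
            have hab' : conn σ α a b := fun S _ h2 => (h2 a).symm
            have hT := @Setoid.trans' _ (conn σ α)
            have hS := @Setoid.symm' _ (conn σ α)
            rcases h with h | ⟨h | h, h' | h'⟩
            · exact hle _ _ h
            · exact hT (hS (hle _ _ h)) (hle _ _ h')
            · exact hT (hS (hle _ _ h)) (hT hab' (hle _ _ h'))
            · exact hT (hS (hle _ _ h)) (hT (hS hab') (hle _ _ h'))
            · exact hT (hS (hle _ _ h)) (hle _ _ h')
        have : cyc (β * σ) = cyc (α * σ) + 1 := by
          rw [hασ]
          refine cyc_sw_mul_of_not_sameCycle fun h2 => hab fun S h3 h4 => ?_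
          exact SameCycle.pred_iff (fun z => by rw [Perm.mul_apply, h4, h3]) h2
        omega

/-- A fixed-point-free involution pairs the elements. -/
theorem two_mul_cyc_of_involutive [Finite D] {α : Perm D} (h1 : ∀ x, α (α x) = x)
    (h2 : ∀ x, α x ≠ x) : 2 * cyc α = Nat.card D := by
  classical
  have := Fintype.ofFinite D
  unfold cyc
  have hsc : ∀ x y, α.SameCycle x y ↔ y = x ∨ y = α x := by
    intro x y
    refine ⟨fun h => ?_, ?_⟩
    · refine (SameCycle.pred_iff (S := fun z => z = x ∨ z = α x) (fun z => ?_) h).1 (Or.inl rfl)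
      have := h1 z
      have e : α z = x ↔ z = α x := ⟨fun h => by rw [← h, h1], fun h => by rw [h, h1]⟩
      rw [e, α.injective.eq_iff, or_comm]
    · rintro (rfl | rfl) <;> simp [SameCycle.refl]
  rw [Nat.card_eq_fintype_card, Nat.card_eq_fintype_card, ← Finset.card_univ (α := D),
    Finset.card_eq_sum_card_fiberwise (f := fun x => (Quotient.mk (SameCycle.setoid α) x))
      (t := Finset.univ) (fun _ _ => Finset.mem_coe.2 (Finset.mem_univ _))]
  rw [Finset.sum_const_nat (m := 2), Finset.card_univ, mul_comm]
  intro c _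
  induction c using Quotient.inductionOn with | _ x
  rw [Finset.card_eq_two]
  refine ⟨x, α x, (h2 x).symm, ?_⟩
  ext y
  simp only [Finset.mem_filter, Finset.mem_univ, true_and, Finset.mem_insert, Finset.mem_singleton]
  rw [← hsc]
  exact ⟨fun h => (Quotient.exact h).symm, fun h => Quotient.sound h.symm⟩

/-- Going once around a cycle, from `f r` back to `r`. -/
theorem pred_around_cycle [Finite D] {f : Perm D} {r : D} {S : D → Prop}
    (h : ∀ x, f.SameCycle r x → x ≠ r → (S (f x) ↔ S x)) : S (f r) ↔ S r := by
  -- If `T r` failed, `T` would propagate along all iterates from `f r` without meeting `r`,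
  -- contradicting that they return to `r`. Applying this to `S` and to its negation gives both
  -- implications.
  have key : ∀ T : D → Prop, (∀ x, f.SameCycle r x → x ≠ r → (T x → T (f x))) →
      T (f r) → T r := by
    intro T hT h1
    by_contra hr
    have : ∀ k : ℕ, T ((f ^ (k + 1)) r) := by
      intro k
      induction k with
      | zero => simpa
      | succ k ih =>
        rw [pow_succ', Perm.mul_apply]
        exact hT _ (by simp [SameCycle.refl]) (fun h => hr (h ▸ ih)) ih
    have h2 := this (orderOf f - 1)
    rw [Nat.sub_add_cancel (orderOf_pos f), pow_orderOf_eq_one] at h2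
    exact hr h2
  refine ⟨key S fun x hx hxr => (h x hx hxr).2, fun hr => ?_⟩
  by_contra h1
  exact key (fun x => ¬ S x) (fun x hx hxr => mt (h x hx hxr).1) h1 hr

end MapEnum

/-! ### Rooted maps in terms of darts -/

namespace RootedMap

open Equiv (Perm)
open Equiv.Perm MapEnum

variable {D D' : Type*}

/-- The permutation whose cycles are the faces. -/
def φ (M : RootedMap D) : Perm D := M.σ * M.α

theorem φ_apply (M : RootedMap D) (d : D) : M.φ d = M.σ (M.α d) := rfl

theorem conn_all (M : RootedMap D) (a b : D) : conn M.σ M.α a b := by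
  intro S h1 h2
  obtain ⟨g, hg, rfl⟩ := M.connected a b
  have : ∀ x, S (g x) ↔ S x := by
    induction hg using Subgroup.closure_induction with
    | mem g hg =>
      rcases hg with rfl | rfl
      · exact h1
      · exact h2
    | one => intro x; rfl
    | mul f g _ _ hf hg => intro x; rw [Perm.mul_apply, hf, hg]
    | inv f _ hf =>
      intro x
      rw [← hf]; simp
  exact (this a).symm

theorem connected_step {σ α τ : Perm D} (hτ : τ ∈ ({σ, α} : Set (Perm D))) {a : D} (z : D) :
    (∃ g ∈ Subgroup.closure {σ, α}, g a = τ z) ↔ ∃ g ∈ Subgroup.closure {σ, α}, g a = z := by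
  constructor
  · rintro ⟨g, hg, hgz⟩
    exact ⟨τ⁻¹ * g, Subgroup.mul_mem _ (Subgroup.inv_mem _ (Subgroup.subset_closure hτ)) hg, by
      rw [Perm.mul_apply, hgz, Perm.inv_eq_iff_eq]⟩
  · rintro ⟨g, hg, rfl⟩
    exact ⟨τ * g, Subgroup.mul_mem _ (Subgroup.subset_closure hτ) hg, rfl⟩

theorem connected_of_conn {σ α : Perm D} (h : ∀ a b, conn σ α a b) (a b : D) :
    ∃ g ∈ Subgroup.closure {σ, α}, g a = b := by
  refine (h a b (fun z => ∃ g ∈ Subgroup.closure {σ, α}, g a = z) ?_ ?_).1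
    ⟨1, Subgroup.one_mem _, rfl⟩
  all_goals intro z
  · exact connected_step (by simp) z
  · exact connected_step (by simp) z

theorem euler_cyc (M : RootedMap D) : cyc M.σ + cyc M.φ = cyc M.α + 2 := M.euler

/-- The class `T`, in terms of darts. -/
structure IsTD (M : RootedMap D) : Prop where
  loopless : ∀ d, ¬ M.σ.SameCycle d (M.α d)
  nonsep : ∀ c, ∀ S : D → Prop, (∀ x, S (M.σ x) ↔ S x) →
    (∀ x, ¬ M.σ.SameCycle c x → ¬ M.σ.SameCycle c (M.α x) → (S (M.α x) ↔ S x)) →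
    ∀ a b, ¬ M.σ.SameCycle c a → ¬ M.σ.SameCycle c b → (S a ↔ S b)
  tri : ∀ d, ¬ M.φ.SameCycle M.root d → M.φ (M.φ (M.φ d)) = d
  deg : ∀ d, (∀ y, M.φ.SameCycle M.root y → ¬ M.σ.SameCycle d y) →
    M.σ d ≠ d ∧ M.σ (M.σ d) ≠ d

end RootedMap

/-! ### Degrees as cycle lengths -/

namespace MapEnum

open Equiv (Perm)
open Equiv.Perm

variable {D D' : Type*}

theorem card_sameCycle [Finite D] (f : Perm D) (d : D) :
    Nat.card {y // f.SameCycle d y} = Function.minimalPeriod f d := by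
  have := Fintype.ofFinite D
  have h1 : {y | f.SameCycle d y} = MulAction.orbit (Subgroup.zpowers f) d := by
    ext y
    constructor
    · rintro ⟨n, rfl⟩
      exact ⟨⟨f ^ n, n, rfl⟩, rfl⟩
    · rintro ⟨⟨_, n, rfl⟩, rfl⟩
      exact ⟨n, rfl⟩
  have : Fintype (MulAction.orbit (Subgroup.zpowers f) d) := Fintype.ofFinite _
  have h2 := MulAction.minimalPeriod_eq_card (α := Perm D) (β := D) (a := f) (b := d)
  rw [← Nat.card_eq_fintype_card, ← h1] at h2
  exact h2.symm

theorem minimalPeriod_pos_of_finite [Finite D] (f : Perm D) (d : D) :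
    0 < Function.minimalPeriod f d := by
  rw [← card_sameCycle, Nat.card_pos_iff]
  exact ⟨⟨d, SameCycle.refl _ _⟩, inferInstance⟩

/-- The period divides 3, which is prime, and it is not 1 because `d` is not fixed. -/
theorem card_sameCycle_eq_three_iff [Finite D] (f : Perm D) (d : D) (h : f d ≠ d) :
    Nat.card {y // f.SameCycle d y} = 3 ↔ f (f (f d)) = d := by
  rw [card_sameCycle]
  constructor
  · intro h3
    have := Function.iterate_minimalPeriod (f := f) (x := d)
    rwa [h3] at this
  · intro h3
    have h4 : Function.IsPeriodicPt f 3 d := h3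
    rcases (Nat.dvd_prime Nat.prime_three).1 h4.minimalPeriod_dvd with h5 | h5
    · exact absurd (Function.minimalPeriod_eq_one_iff_isFixedPt.1 h5) h
    · exact h5

theorem three_le_card_sameCycle_iff [Finite D] (f : Perm D) (d : D) :
    3 ≤ Nat.card {y // f.SameCycle d y} ↔ f d ≠ d ∧ f (f d) ≠ d := by
  rw [card_sameCycle]
  constructor
  · intro h
    refine ⟨fun h1 => ?_, fun h2 => ?_⟩
    · have h3 : Function.IsPeriodicPt f 1 d := h1
      have := Nat.le_of_dvd one_pos h3.minimalPeriod_dvd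
      omega
    · have h3 : Function.IsPeriodicPt f 2 d := h2
      have := Nat.le_of_dvd two_pos h3.minimalPeriod_dvd
      omega
  · rintro ⟨h1, h2⟩
    have h0 := minimalPeriod_pos_of_finite f d
    have h3 := Function.iterate_minimalPeriod (f := f) (x := d)
    by_contra! h4
    interval_cases hm : Function.minimalPeriod f d
    · exact h1 h3
    · exact h2 h3

theorem two_le_card_sameCycle [Finite D] (f : Perm D) (d : D) (h : f d ≠ d) :
    2 ≤ Nat.card {y // f.SameCycle d y} := by
  have h0 := minimalPeriod_pos_of_finite f d
  have h3 := Function.iterate_minimalPeriod (f := f) (x := d)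
  rw [card_sameCycle]
  by_contra! h4
  interval_cases hm : Function.minimalPeriod f d
  exact h h3

end MapEnum

/-! ### From vertices and faces to darts -/

namespace RootedMap

open Equiv (Perm)
open Equiv.Perm MapEnum

variable {D D' : Type*}

theorem origin_eq_iff (M : RootedMap D) {a b : D} :
    M.origin a = M.origin b ↔ M.σ.SameCycle a b := Quotient.eq

theorem rightFace_eq_iff (M : RootedMap D) {a b : D} :
    M.rightFace a = M.rightFace b ↔ M.φ.SameCycle a b := Quotient.eq

theorem vertexDegree_origin (M : RootedMap D) (d : D) :
    M.vertexDegree (M.origin d) = Nat.card {y // M.σ.SameCycle d y} :=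
  Nat.card_congr (Equiv.subtypeEquivRight fun y => by
    rw [origin_eq_iff, sameCycle_comm])

theorem faceDegree_rightFace (M : RootedMap D) (d : D) :
    M.faceDegree (M.rightFace d) = Nat.card {y // M.φ.SameCycle d y} :=
  Nat.card_congr (Equiv.subtypeEquivRight fun y => by
    rw [rightFace_eq_iff, sameCycle_comm])

theorem loopless_iff (M : RootedMap D) : M.Loopless ↔ ∀ d, ¬ M.σ.SameCycle d (M.α d) :=
  forall_congr' fun d => by rw [Ne, origin_eq_iff, sameCycle_comm]

/-- A predicate invariant under `M.σ` descends to vertices and can be followed along walks.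
Conversely, the predicate to test is reachability from a given vertex. -/
theorem preconnected_iff (M : RootedMap D) (c : D) :
    (M.graph.induce {M.origin c}ᶜ).Preconnected ↔
    ∀ S : D → Prop, (∀ x, S (M.σ x) ↔ S x) →
    (∀ x, ¬ M.σ.SameCycle c x → ¬ M.σ.SameCycle c (M.α x) → (S (M.α x) ↔ S x)) →
    ∀ a b, ¬ M.σ.SameCycle c a → ¬ M.σ.SameCycle c b → (S a ↔ S b) := by
  have hmem : ∀ x, M.origin x ∈ ({M.origin c}ᶜ : Set M.Vertex) ↔ ¬ M.σ.SameCycle c x := by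
    intro x
    rw [Set.mem_compl_iff, Set.mem_singleton_iff, origin_eq_iff, sameCycle_comm]
  constructor
  · intro h S h1 h2 a b ha hb
    let T : M.Vertex → Prop := Quotient.lift S fun x y hxy => propext (SameCycle.pred_iff h1 hxy)
    have hT : ∀ x, T (M.origin x) ↔ S x := fun x => Iff.rfl
    obtain ⟨w⟩ := h ⟨M.origin a, (hmem a).2 ha⟩ ⟨M.origin b, (hmem b).2 hb⟩
    have key : ∀ u v : ({M.origin c}ᶜ : Set M.Vertex),
        (M.graph.induce {M.origin c}ᶜ).Walk u v → (T u.1 ↔ T v.1) := by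
      intro u v w
      induction w with
      | nil => rfl
      | @cons u v w huv _ ih =>
        rw [← ih]
        obtain ⟨u, hu⟩ := u
        obtain ⟨v, hv⟩ := v
        obtain ⟨_, d, rfl, rfl⟩ := huv
        exact (h2 d ((hmem _).1 hu) ((hmem _).1 hv)).symm
    exact key _ _ w
  · rintro h ⟨u, hu⟩ ⟨v, hv⟩
    obtain ⟨a, rfl⟩ : ∃ a, M.origin a = u := Quotient.exists_rep u
    obtain ⟨b, rfl⟩ : ∃ a, M.origin a = v := Quotient.exists_rep v
    refine ((h (fun z => ∃ hz : M.origin z ∈ ({M.origin c}ᶜ : Set M.Vertex),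
      (M.graph.induce {M.origin c}ᶜ).Reachable ⟨M.origin a, hu⟩ ⟨M.origin z, hz⟩) ?_ ?_ a b
      ((hmem _).1 hu) ((hmem _).1 hv)).1 ⟨hu, SimpleGraph.Reachable.refl _⟩).2
    · intro x
      have : M.origin (M.σ x) = M.origin x := by
        rw [origin_eq_iff]; exact sameCycle_apply_left.2 (SameCycle.refl _ _)
      simp only [this]
    · intro x hx hx'
      have key : ∀ y, ¬ M.σ.SameCycle c y → ¬ M.σ.SameCycle c (M.α y) →
          (∃ hz : M.origin y ∈ ({M.origin c}ᶜ : Set M.Vertex),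
            (M.graph.induce {M.origin c}ᶜ).Reachable ⟨M.origin a, hu⟩ ⟨M.origin y, hz⟩) →
          (∃ hz : M.origin (M.α y) ∈ ({M.origin c}ᶜ : Set M.Vertex),
            (M.graph.induce {M.origin c}ᶜ).Reachable ⟨M.origin a, hu⟩
              ⟨M.origin (M.α y), hz⟩) := by
        rintro y hy hy' ⟨hz, hr⟩
        refine ⟨(hmem _).2 hy', ?_⟩
        -- `graph` has no edge for a loop, but the two ends of a loop are the same vertex.
        by_cases he : M.origin y = M.origin (M.α y)
        · simpa only [he] using hr
        · exact hr.trans (SimpleGraph.Adj.reachable ⟨he, y, rfl, rfl⟩)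
      refine ⟨fun hr => ?_, key x hx hx'⟩
      have := key (M.α x) hx' (by rwa [M.α_invol]) hr
      rwa [M.α_invol] at this

theorem isT_iff [Finite D] (M : RootedMap D) : M.IsT ↔ M.IsTD := by
  have hns : (∀ v : M.Vertex, (M.graph.induce {v}ᶜ).Preconnected) ↔
      ∀ c, (M.graph.induce {M.origin c}ᶜ).Preconnected :=
    ⟨fun h c => h _, fun h v => by
      obtain ⟨c, rfl⟩ : ∃ a, M.origin a = v := Quotient.exists_rep v
      exact h c⟩
  have htri : M.Loopless → (M.IsNearTriangulation ↔
      ∀ d, ¬ M.φ.SameCycle M.root d → M.φ (M.φ (M.φ d)) = d) := by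
    intro hl
    -- Looplessness rules out faces of degree 1, which also satisfy the equation on the right.
    have key : ∀ d, M.faceDegree (M.rightFace d) = 3 ↔ M.φ (M.φ (M.φ d)) = d := by
      intro d
      rw [faceDegree_rightFace, card_sameCycle_eq_three_iff]
      intro h
      apply (M.loopless_iff.1 hl) d
      have : M.σ.SameCycle (M.φ d) (M.α d) := by
        rw [φ_apply, sameCycle_apply_left]
      rwa [h] at this
    constructor
    · intro h d hd
      rw [← key]
      refine h _ fun h' => hd ?_
      exact (M.rightFace_eq_iff.1 h').symm
    · intro h f hf
      obtain ⟨d, rfl⟩ : ∃ a, M.rightFace a = f := Quotient.exists_rep f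
      rw [key]
      exact h d fun h' => hf (M.rightFace_eq_iff.2 h'.symm)
  have hdeg : (∀ v : M.Vertex, ¬ M.IsExternal v → 3 ≤ M.vertexDegree v) ↔
      ∀ d, (∀ y, M.φ.SameCycle M.root y → ¬ M.σ.SameCycle d y) →
        M.σ d ≠ d ∧ M.σ (M.σ d) ≠ d := by
    have key : ∀ d, M.IsExternal (M.origin d) ↔
        ∃ y, M.φ.SameCycle M.root y ∧ M.σ.SameCycle d y := by
      intro d
      refine exists_congr fun y => ?_
      rw [origin_eq_iff, rootFace, rightFace_eq_iff, sameCycle_comm,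
        sameCycle_comm (f := M.σ)]
    constructor
    · intro h d hd
      rw [← three_le_card_sameCycle_iff, ← vertexDegree_origin]
      refine h _ fun h' => ?_
      obtain ⟨y, h1, h2⟩ := (key d).1 h'
      exact hd y h1 h2
    · intro h v hv
      obtain ⟨d, rfl⟩ : ∃ a, M.origin a = v := Quotient.exists_rep v
      rw [vertexDegree_origin, three_le_card_sameCycle_iff]
      exact h d fun y h1 h2 => hv ((key d).2 ⟨y, h1, h2⟩)
  constructor
  · rintro ⟨⟨h1, h2⟩, h3, h4⟩
    exact ⟨M.loopless_iff.1 h1, fun c => (M.preconnected_iff c).1 (h2 _), (htri h1).1 h3,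
      hdeg.1 h4⟩
  · rintro ⟨h1, h2, h3, h4⟩
    have hl := M.loopless_iff.2 h1
    exact ⟨⟨hl, hns.2 fun c => (M.preconnected_iff c).2 (h2 c)⟩, (htri hl).2 h3, hdeg.2 h4⟩

/-! ### Isomorphisms -/

theorem Iso.refl (M : RootedMap D) : M.Iso M := ⟨Equiv.refl _, fun _ => rfl, fun _ => rfl, rfl⟩

theorem Iso.symm {M : RootedMap D} {N : RootedMap D'} (h : M.Iso N) : N.Iso M := by
  obtain ⟨e, h1, h2, h3⟩ := h
  refine ⟨e.symm, fun d => ?_, fun d => ?_, ?_⟩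
  · rw [Equiv.symm_apply_eq, h1, Equiv.apply_symm_apply]
  · rw [Equiv.symm_apply_eq, h2, Equiv.apply_symm_apply]
  · rw [Equiv.symm_apply_eq, h3]

theorem Iso.trans {D'' : Type*} {M : RootedMap D} {N : RootedMap D'} {P : RootedMap D''}
    (h : M.Iso N) (h' : N.Iso P) : M.Iso P := by
  obtain ⟨e, h1, h2, h3⟩ := h
  obtain ⟨f, g1, g2, g3⟩ := h'
  exact ⟨e.trans f, fun d => by simp [h1, g1], fun d => by simp [h2, g2], by simp [h3, g3]⟩

theorem map_φ {M : RootedMap D} {N : RootedMap D'} {e : D ≃ D'} (h1 : ∀ d, e (M.σ d) = N.σ (e d))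
    (h2 : ∀ d, e (M.α d) = N.α (e d)) (d : D) : e (M.φ d) = N.φ (e d) := by
  rw [φ_apply, φ_apply, h1, h2]

theorem IsTD.of_iso {M : RootedMap D} {N : RootedMap D'} (h : M.Iso N) (hM : M.IsTD) :
    N.IsTD := by
  obtain ⟨e, h1, h2, h3⟩ := h.symm
  have hφ := map_φ h1 h2
  have hσ := sameCycle_map e h1
  have hf := sameCycle_map e hφ
  refine ⟨fun d => ?_, fun c S hS1 hS2 a b ha hb => ?_, fun d hd => ?_, fun d hd => ?_⟩
  · rw [hσ, h2]; exact hM.loopless _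
  · rw [hσ] at ha hb
    have := hM.nonsep (e c) (fun z => S (e.symm z)) (fun x => ?_) (fun x hx hx' => ?_) _ _ ha hb
    · simpa using this
    · obtain ⟨y, rfl⟩ := e.surjective x
      rw [← h1]; simpa using hS1 y
    · obtain ⟨y, rfl⟩ := e.surjective x
      rw [← h2, ← hσ] at hx'
      rw [← hσ] at hx
      rw [← h2]; simpa using hS2 y hx hx'
  · rw [hf, h3] at hd
    apply e.injective
    rw [hφ, hφ, hφ]
    exact hM.tri _ hd
  · have := hM.deg (e d) fun y hy => by
      obtain ⟨z, rfl⟩ := e.surjective y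
      rw [← hσ]
      exact hd z (by rwa [hf, h3])
    rwa [← h1, ← h1, e.injective.ne_iff, e.injective.ne_iff] at this

/-- Transport along a bijection of the darts. -/
def transport (M : RootedMap D) (e : D ≃ D') : RootedMap D' where
  σ := (e.symm.trans M.σ).trans e
  α := (e.symm.trans M.α).trans e
  root := e M.root
  α_invol d := by simp [M.α_invol]
  α_ne d := by simp [← Equiv.eq_symm_apply, M.α_ne]
  connected := by
    refine connected_of_conn fun a b S h1 h2 => ?_
    have := M.conn_all (e.symm a) (e.symm b) (fun z => S (e z)) (fun z => by
      rw [← h1 (e z)]; simp) (fun z => by rw [← h2 (e z)]; simp)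
    simpa using this
  euler := by
    have := M.euler_cyc
    rw [cyc_map (f := M.σ) (g := (e.symm.trans M.σ).trans e) e (by simp),
      cyc_map (f := M.α) (g := (e.symm.trans M.α).trans e) e (by simp),
      cyc_map (f := M.φ) (g := (e.symm.trans M.σ).trans e * (e.symm.trans M.α).trans e) e
        (by simp [φ_apply])] at this
    exact this

theorem iso_transport (M : RootedMap D) (e : D ≃ D') : M.Iso (M.transport e) :=
  ⟨e, fun d => by simp [transport], fun d => by simp [transport], rfl⟩

/-- The same map with another root. -/
def reroot (M : RootedMap D) (r : D) : RootedMap D := { M with root := r }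

theorem IsTD.reroot {M : RootedMap D} (h : M.IsTD) {r : D} (hr : M.φ.SameCycle M.root r) :
    (M.reroot r).IsTD where
  loopless := h.loopless
  nonsep := h.nonsep
  tri d hd := h.tri d fun h' => hd (hr.symm.trans h')
  deg d hd := h.deg d fun y hy => hd y (hr.symm.trans hy)

/-! ### The Jordan curve property -/

theorem card_darts (M : RootedMap D) [Finite D] : 2 * cyc M.α = Nat.card D :=
  two_mul_cyc_of_involutive M.α_invol M.α_ne

/-- Cutting a planar map at two corners of a vertex that lie in the same face disconnects it. -/
theorem not_conn_cut [Finite D] (M : RootedMap D) {a b : D} (hab : a ≠ b)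
    (hσ : M.σ.SameCycle a b) (hφ : M.φ.SameCycle a b) : ¬ conn (sw a b * M.σ) M.α a b := by
  intro hc
  have : Nonempty D := ⟨a⟩
  have h1 : ∀ x y, conn (sw a b * M.σ) M.α x y := by
    intro x y S hS1 hS2
    refine M.conn_all x y S (fun z => ?_) hS2
    rw [← hS1 z, Perm.mul_apply, sw_pred (hc S hS1 hS2)]
  -- The cut splits one vertex and one face, adding 2 to `V + F`. If the result were connected, it
  -- would exceed the genus bound.
  have h2 := genus_bound (sw a b * M.σ) M.α
  rw [card_conn_eq_one h1, cyc_mul_comm M.α, mul_assoc] at h2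
  change _ + cyc (sw a b * M.φ) ≤ _ at h2
  rw [cyc_sw_mul_of_sameCycle hσ hab, cyc_sw_mul_of_sameCycle hφ hab] at h2
  have h3 := M.euler_cyc
  have h4 := M.card_darts
  omega

theorem conn_cut (M : RootedMap D) (a b x : D) :
    conn (sw a b * M.σ) M.α a x ∨ conn (sw a b * M.σ) M.α b x := by
  refine (M.conn_all a x (fun z => conn (sw a b * M.σ) M.α a z ∨ conn (sw a b * M.σ) M.α b z)
    (fun z => ?_) (fun z => by simp only [conn_right])).1 (Or.inl ((conn _ _).refl a))
  rw [← sw_pred (a := a) (b := b) (S := fun z => conn (sw a b * M.σ) M.α a z ∨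
    conn (sw a b * M.σ) M.α b z), ← Perm.mul_apply]
  · simp only [conn_left]
  · have h1 := (conn (sw a b * M.σ) M.α).refl a
    have h2 := (conn (sw a b * M.σ) M.α).refl b
    tauto

/-- In a nonseparable planar map, a face visits a vertex at most once. -/
theorem IsTD.eq_of_sameCycle [Finite D] {M : RootedMap D} (h : M.IsTD) {a b : D}
    (hσ : M.σ.SameCycle a b) (hφ : M.φ.SameCycle a b) : a = b := by
  by_contra hab
  refine M.not_conn_cut hab hσ hφ fun P hP1 hP2 => ?_
  have hnot : ∀ x, M.σ.SameCycle a x → ¬ M.σ.SameCycle a (M.α x) := fun x hx hx' =>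
    h.loopless x (hx.symm.trans hx')
  -- The cut alters `M.σ` only at the vertex of `a`, so once that vertex is deleted `P` is invariant
  -- in `M` itself. The neighbours `M.α a` and `M.α b` survive the deletion because there are no
  -- loops, and they carry `P` from one side of the cut to the other.
  have := h.nonsep a (fun x => P x ∧ ¬ M.σ.SameCycle a x) (fun x => ?_) (fun x hx hx' => ?_)
    (M.α a) (M.α b) (hnot a (SameCycle.refl _ _)) (hnot b hσ)
  · simpa [hP2, hnot a (SameCycle.refl _ _), hnot b hσ] using this
  · rw [sameCycle_apply_right]
    by_cases hx : M.σ.SameCycle a x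
    · simp [hx]
    · simp only [hx, not_false_eq_true, and_true]
      rw [← hP1 x, Perm.mul_apply, sw_of_ne]
      · rintro he
        exact hx (by rw [← sameCycle_apply_right, he])
      · rintro he
        exact hx (by rw [← sameCycle_apply_right, he]; exact hσ)
  · simp [hx, hx', hP2]

/-- A vertex of degree one is isolated once its only neighbour is deleted, so nonseparability leaves
no other vertex: the map is a single edge. -/
theorem IsTD.eq_of_fixed {M : RootedMap D} (h : M.IsTD) {a : D} (ha : M.σ a = a) (x : D) :
    x = a ∨ x = M.α a := by
  have hnot : ∀ x, M.σ.SameCycle (M.α a) x → ¬ M.σ.SameCycle (M.α a) (M.α x) := fun x hx hx' =>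
    h.loopless x (hx.symm.trans hx')
  have h0 : ¬ M.σ.SameCycle (M.α a) a := fun h' => h.loopless a h'.symm
  have key : ∀ y, ¬ M.σ.SameCycle (M.α a) y → y = a := by
    intro y hy
    refine (h.nonsep (M.α a) (fun x => x = a) (fun x => ?_) (fun x hx hx' => ?_) a y h0 hy).1 rfl
    · conv_lhs => rw [← ha]
      exact M.σ.injective.eq_iff
    · refine ⟨fun h1 => ?_, fun h1 => ?_⟩
      · exfalso; apply hx; rw [← h1, M.α_invol]
      · exfalso; apply hx'; rw [h1]
  by_cases hx : M.σ.SameCycle (M.α a) x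
  · right
    rw [← key _ (hnot x hx), M.α_invol]
  · exact Or.inl (key x hx)

theorem IsTD.φ_ne {M : RootedMap D} (h : M.IsTD) (d : D) : M.φ d ≠ d := by
  intro h'
  apply h.loopless d
  conv_lhs => rw [← h']
  rw [φ_apply, sameCycle_apply_left]

end RootedMap

/-! ### Closing a map by a new root edge -/

namespace MapEnum

open Equiv (Perm)
open Equiv.Perm

variable {D D' : Type*}

/-- The rotation system obtained by inserting one dart just before `p` and one just before `w`. -/
noncomputable def closeσ (σ : Perm D) (p w : D) : Perm (D ⊕ Bool) :=
  sw (Sum.inr true) (Sum.inl p) * (sw (Sum.inr false) (Sum.inl w) * sumCongr σ 1)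

/-- The edge involution with a new edge added. -/
def closeα (α : Perm D) : Perm (D ⊕ Bool) := sumCongr α Equiv.boolNot

/-- Sends the two new darts to the old ones next to them in the rotation. -/
def retract (p w : D) : D ⊕ Bool → D := Sum.elim id fun b => if b then p else w

@[simp] theorem retract_inl (p w x : D) : retract p w (Sum.inl x) = x := rfl
@[simp] theorem retract_true (p w : D) : retract p w (Sum.inr true) = p := rfl
@[simp] theorem retract_false (p w : D) : retract p w (Sum.inr false) = w := rfl

@[simp] theorem closeα_inl (α : Perm D) (x : D) : closeα α (Sum.inl x) = Sum.inl (α x) := rfl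
@[simp] theorem closeα_true (α : Perm D) : closeα α (Sum.inr true) = Sum.inr false := rfl
@[simp] theorem closeα_false (α : Perm D) : closeα α (Sum.inr false) = Sum.inr true := rfl

section

variable (σ α : Perm D) {p w : D}

@[simp] theorem closeσ_true : closeσ σ p w (Sum.inr true) = Sum.inl p := by
  simp only [closeσ, Perm.mul_apply, sumCongr_apply, Sum.map_inr, Perm.one_apply]
  rw [sw_of_ne (a := Sum.inr false) (by simp) (by simp), sw_left]

theorem closeσ_false (hpw : p ≠ w) : closeσ σ p w (Sum.inr false) = Sum.inl w := by
  simp only [closeσ, Perm.mul_apply, sumCongr_apply, Sum.map_inr, Perm.one_apply]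
  rw [sw_left, sw_of_ne (by simp) (by simpa using hpw.symm)]

theorem closeσ_inl_of_eq_right {x : D} (hx : σ x = w) :
    closeσ σ p w (Sum.inl x) = Sum.inr false := by
  simp only [closeσ, Perm.mul_apply, sumCongr_apply, Sum.map_inl, hx]
  rw [sw_right, sw_of_ne (by simp) (by simp)]

theorem closeσ_inl_of_eq_left (hpw : p ≠ w) {x : D} (hx : σ x = p) :
    closeσ σ p w (Sum.inl x) = Sum.inr true := by
  simp only [closeσ, Perm.mul_apply, sumCongr_apply, Sum.map_inl, hx]
  rw [sw_of_ne (a := Sum.inr false) (by simp) (by simpa using hpw), sw_right]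

theorem closeσ_inl_of_ne {x : D} (h1 : σ x ≠ w) (h2 : σ x ≠ p) :
    closeσ σ p w (Sum.inl x) = Sum.inl (σ x) := by
  simp only [closeσ, Perm.mul_apply, sumCongr_apply, Sum.map_inl]
  rw [sw_of_ne (a := Sum.inr false) (by simp) (by simpa using h1),
    sw_of_ne (by simp) (by simpa using h2)]

theorem closeσ_inl_cases (hpw : p ≠ w) (x : D) :
    (σ x = w ∧ closeσ σ p w (Sum.inl x) = Sum.inr false) ∨
    (σ x = p ∧ closeσ σ p w (Sum.inl x) = Sum.inr true) ∨
    (σ x ≠ w ∧ σ x ≠ p ∧ closeσ σ p w (Sum.inl x) = Sum.inl (σ x)) := by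
  by_cases h1 : σ x = w
  · exact Or.inl ⟨h1, closeσ_inl_of_eq_right σ h1⟩
  · by_cases h2 : σ x = p
    · exact Or.inr (Or.inl ⟨h2, closeσ_inl_of_eq_left σ hpw h2⟩)
    · exact Or.inr (Or.inr ⟨h1, h2, closeσ_inl_of_ne σ h1 h2⟩)

theorem retract_closeσ_inl (hpw : p ≠ w) (x : D) : retract p w (closeσ σ p w (Sum.inl x)) = σ x := by
  rcases closeσ_inl_cases σ hpw x with ⟨h1, h2⟩ | ⟨h1, h2⟩ | ⟨_, _, h2⟩ <;> rw [h2]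
  · rw [h1]; rfl
  · rw [h1]; rfl
  · rfl

theorem inl_eq_closeσ (p w x : D) : Sum.inl (σ x) = sw (Sum.inr false) (Sum.inl w)
    (sw (Sum.inr true) (Sum.inl p) (closeσ σ p w (Sum.inl x))) := by
  simp [closeσ]

/-- Predicates invariant under `closeσ`. -/
theorem closeσ_pred (hpw : p ≠ w) (S : D → Prop) (hS : ∀ x, S (σ x) ↔ S x) (u : D ⊕ Bool) :
    S (retract p w (closeσ σ p w u)) ↔ S (retract p w u) := by
  rcases u with x | (_ | _)
  · rw [retract_closeσ_inl σ hpw, hS]; rfl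
  · rw [closeσ_false σ hpw]; rfl
  · rw [closeσ_true]; rfl

/-- Each new dart is followed, in its cycle, by the old dart to which `retract` sends it, so an
invariant predicate is determined by its values on old darts. -/
theorem closeσ_pred_inl (hpw : p ≠ w) (S : D ⊕ Bool → Prop) (hS : ∀ u, S (closeσ σ p w u) ↔ S u) :
    (∀ x, S (Sum.inl (σ x)) ↔ S (Sum.inl x)) ∧ (∀ u, S u ↔ S (Sum.inl (retract p w u))) := by
  have h1 : ∀ u, S u ↔ S (Sum.inl (retract p w u)) := by
    rintro (x | (_ | _))
    · rfl
    · rw [← hS (Sum.inr false), closeσ_false σ hpw]; rfl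
    · rw [← hS (Sum.inr true), closeσ_true]; rfl
  exact ⟨fun x => by rw [← hS (Sum.inl x), h1 (closeσ _ _ _ _), retract_closeσ_inl σ hpw], h1⟩

theorem sameCycle_closeσ (hpw : p ≠ w) (u v : D ⊕ Bool) :
    (closeσ σ p w).SameCycle u v ↔ σ.SameCycle (retract p w u) (retract p w v) := by
  constructor
  · intro h
    refine (SameCycle.pred_iff (S := fun v => σ.SameCycle (retract p w u) (retract p w v)) ?_ h).1
      (SameCycle.refl _ _)
    exact closeσ_pred σ hpw (fun x => σ.SameCycle (retract p w u) x) fun x => sameCycle_apply_right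
  · intro h
    obtain ⟨h1, h2⟩ := closeσ_pred_inl σ hpw (fun v => (closeσ σ p w).SameCycle u v)
      (fun u => sameCycle_apply_right)
    rw [h2]
    refine (SameCycle.pred_iff (S := fun x => (closeσ σ p w).SameCycle u (Sum.inl x)) h1 h).1 ?_
    rw [← h2]

variable [Finite D]

/-- The two new darts start as fixed points, which adds two cycles, and each transposition absorbs
one of them. -/
theorem cyc_closeσ : cyc (closeσ σ p w) = cyc σ := by
  have h0 : cyc (sumCongr σ (1 : Perm Bool)) = cyc σ + 2 := by
    rw [cyc_sumCongr, cyc_one]; simp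
  have h1 := cyc_sw_mul_of_not_sameCycle (not_sameCycle_inr_inl σ (1 : Perm Bool) w false)
  have h2 : ¬ (sw (Sum.inr false) (Sum.inl w) * sumCongr σ (1 : Perm Bool)).SameCycle
      (Sum.inr true) (Sum.inl p) := by
    rw [sameCycle_sw_mul (not_sameCycle_inr_inl σ (1 : Perm Bool) w false)]
    have e1 := not_sameCycle_inr_inl σ (1 : Perm Bool) p true
    have e2 := not_sameCycle_inl_inr σ (1 : Perm Bool) w true
    have e3 : ¬ (sumCongr σ (1 : Perm Bool)).SameCycle (Sum.inr false) (Sum.inr true) := by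
      rw [sameCycle_inr_inr, sameCycle_one]; simp
    tauto
  have h3 := cyc_sw_mul_of_not_sameCycle h2
  change _ = cyc (closeσ σ p w) + 1 at h3
  omega

theorem cyc_boolNot : cyc (Equiv.boolNot : Perm Bool) = 1 := by
  have := two_mul_cyc_of_involutive (α := (Equiv.boolNot : Perm Bool)) (by simp) (by simp)
  rw [Nat.card_eq_fintype_card, Fintype.card_bool] at this
  omega

theorem cyc_closeα : cyc (closeα α) = cyc α + 1 := by
  rw [closeα, cyc_sumCongr, cyc_boolNot]

/-- The new edge starts as a separate face, its own 2-cycle. The first transposition merges it into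
the face of `w`; since `p` lies on that face too, the second one splits it again. On balance one
face is added. -/
theorem cyc_closeσ_mul_closeα (h : (σ * α).SameCycle w p) :
    cyc (closeσ σ p w * closeα α) = cyc (σ * α) + 1 := by
  have e : closeσ σ p w * closeα α = sw (Sum.inr true) (Sum.inl p) *
      (sw (Sum.inr false) (Sum.inl w) * sumCongr (σ * α) Equiv.boolNot) := by
    ext u
    rcases u with x | b
    · simp [closeσ]
    · cases b <;> simp [closeσ]
  rw [e]
  have h0 : cyc (sumCongr (σ * α) Equiv.boolNot) = cyc (σ * α) + 1 := by
    rw [cyc_sumCongr, cyc_boolNot]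
  have hn := not_sameCycle_inr_inl (σ * α) Equiv.boolNot w false
  have h1 := cyc_sw_mul_of_not_sameCycle hn
  have h2 : (sw (Sum.inr false) (Sum.inl w) * sumCongr (σ * α) Equiv.boolNot).SameCycle
      (Sum.inr true) (Sum.inl p) := by
    rw [sameCycle_sw_mul hn]
    refine Or.inr ⟨Or.inl ?_, Or.inr ?_⟩
    · rw [sameCycle_inr_inr]; exact ⟨1, by simp⟩
    · rwa [sameCycle_inl_inl]
  rw [cyc_sw_mul_of_sameCycle h2 (by simp)]
  omega

end

/-- An equivalence of sums that respects the summands restricts to them. -/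
theorem exists_equiv_inl {A A' B B' : Type*} (e : A ⊕ B ≃ A' ⊕ B')
    (hl : ∀ x, ∃ y, e (Sum.inl x) = Sum.inl y) (hr : ∀ x, ∃ y, e (Sum.inr x) = Sum.inr y) :
    ∃ f : A ≃ A', ∀ x, e (Sum.inl x) = Sum.inl (f x) := by
  choose f hf using hl
  choose g hg using hr
  refine ⟨Equiv.ofBijective f ⟨fun x y h => ?_, fun y => ?_⟩, hf⟩
  · have : e (Sum.inl x) = e (Sum.inl y) := by rw [hf, hf, h]
    simpa using this
  · obtain ⟨x | x, hx⟩ := e.surjective (Sum.inl y)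
    · exact ⟨x, by rw [hf] at hx; simpa using hx⟩
    · rw [hg] at hx; simp at hx

theorem exists_equiv_inr {A A' B B' : Type*} (e : A ⊕ B ≃ A' ⊕ B')
    (hl : ∀ x, ∃ y, e (Sum.inl x) = Sum.inl y) (hr : ∀ x, ∃ y, e (Sum.inr x) = Sum.inr y) :
    ∃ f : B ≃ B', ∀ x, e (Sum.inr x) = Sum.inr (f x) := by
  obtain ⟨f, hf⟩ := exists_equiv_inl (((Equiv.sumComm B A).trans e).trans (Equiv.sumComm A' B'))
    (fun x => by obtain ⟨y, hy⟩ := hr x; exact ⟨y, by simp [hy]⟩)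
    (fun x => by obtain ⟨y, hy⟩ := hl x; exact ⟨y, by simp [hy]⟩)
  refine ⟨f, fun x => ?_⟩
  have := hf x
  rcases h : e (Sum.inr x) with y | y
  · simp [h] at this
  · simpa [h] using this

end MapEnum

namespace RootedMap

open Equiv (Perm)
open Equiv.Perm MapEnum

universe u

variable {D : Type u} {D' : Type*}

/-- The map with a single edge, joining two vertices. -/
def single : RootedMap Bool where
  σ := 1
  α := Equiv.boolNot
  root := true
  α_invol := by simp
  α_ne := by simp
  connected := connected_of_conn fun a b S _ h2 => by
    have := h2 true
    revert a b
    simpa [Bool.forall_bool, iff_comm] using this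
  euler := by
    change cyc 1 + cyc (1 * Equiv.boolNot) = cyc Equiv.boolNot + 2
    rw [one_mul, cyc_boolNot, cyc_one]; simp

/-- A new root edge cuts off the corner between the root `p` and its successor in the root-face. -/
noncomputable def close [Finite D] (M : RootedMap D) (h : M.φ (M.φ M.root) ≠ M.root) :
    RootedMap (D ⊕ Bool) where
  σ := closeσ M.σ M.root (M.φ (M.φ M.root))
  α := closeα M.α
  root := Sum.inr true
  α_invol := by rintro (x | (_ | _)) <;> simp [M.α_invol]
  α_ne := by rintro (x | (_ | _)) <;> simp [M.α_ne]
  connected := connected_of_conn fun u v S h1 h2 => by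
    obtain ⟨h3, h4⟩ := closeσ_pred_inl M.σ h.symm S h1
    rw [h4 u, h4 v]
    exact M.conn_all _ _ (fun x => S (Sum.inl x)) h3 fun x => h2 (Sum.inl x)
  euler := by
    have := M.euler_cyc
    change cyc (closeσ _ _ _) + cyc (closeσ _ _ _ * closeα _) = cyc (closeα _) + 2
    rw [cyc_closeσ, cyc_closeα, cyc_closeσ_mul_closeα]
    · change cyc M.σ + (cyc M.φ + 1) = _
      omega
    · exact sameCycle_apply_left.2 (sameCycle_apply_left.2 (SameCycle.refl _ _))

section Close

variable [Finite D] (M : RootedMap D) (h : M.φ (M.φ M.root) ≠ M.root)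

@[simp] theorem close_root : (M.close h).root = Sum.inr true := rfl
@[simp] theorem close_α_inl (x : D) : (M.close h).α (Sum.inl x) = Sum.inl (M.α x) := rfl
@[simp] theorem close_α_true : (M.close h).α (Sum.inr true) = Sum.inr false := rfl
@[simp] theorem close_α_false : (M.close h).α (Sum.inr false) = Sum.inr true := rfl
@[simp] theorem close_σ_true : (M.close h).σ (Sum.inr true) = Sum.inl M.root := closeσ_true M.σ
@[simp] theorem close_σ_false : (M.close h).σ (Sum.inr false) = Sum.inl (M.φ (M.φ M.root)) :=
  closeσ_false M.σ h.symm
@[simp] theorem close_φ_true : (M.close h).φ (Sum.inr true) = Sum.inl (M.φ (M.φ M.root)) :=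
  close_σ_false M h
@[simp] theorem close_φ_false : (M.close h).φ (Sum.inr false) = Sum.inl M.root :=
  close_σ_true M h

theorem close_φ_inl_cases (x : D) :
    (x = M.φ M.root ∧ (M.close h).φ (Sum.inl x) = Sum.inr false) ∨
    (M.φ x = M.root ∧ (M.close h).φ (Sum.inl x) = Sum.inr true) ∨
    (x ≠ M.φ M.root ∧ M.φ x ≠ M.root ∧ (M.close h).φ (Sum.inl x) = Sum.inl (M.φ x)) := by
  have := closeσ_inl_cases M.σ h.symm (M.α x)
  rwa [← M.φ_apply, M.φ.injective.eq_iff, M.φ.injective.ne_iff] at this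

theorem close_φ_root (h' : M.φ M.root ≠ M.root) :
    (M.close h).φ (Sum.inl M.root) = Sum.inl (M.φ M.root) := by
  rcases M.close_φ_inl_cases h M.root with ⟨h1, _⟩ | ⟨h1, _⟩ | ⟨_, _, h2⟩
  · exact absurd h1.symm h'
  · exact absurd h1 h'
  · exact h2

theorem close_φ_φ_root : (M.close h).φ (Sum.inl (M.φ M.root)) = Sum.inr false :=
  closeσ_inl_of_eq_right M.σ rfl

theorem close_sameCycle_σ (u v : D ⊕ Bool) : (M.close h).σ.SameCycle u v ↔
    M.σ.SameCycle (retract M.root (M.φ (M.φ M.root)) u) (retract M.root (M.φ (M.φ M.root)) v) :=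
  sameCycle_closeσ M.σ h.symm u v

end Close

theorem Iso.close [Finite D] [Finite D'] {M : RootedMap D} {N : RootedMap D'} (hMN : M.Iso N)
    (h : M.φ (M.φ M.root) ≠ M.root) (h' : N.φ (N.φ N.root) ≠ N.root) :
    (M.close h).Iso (N.close h') := by
  obtain ⟨e, h1, h2, h3⟩ := hMN
  have hφ := map_φ h1 h2
  refine ⟨Equiv.sumCongr e (Equiv.refl _), fun u => ?_, fun u => ?_, rfl⟩
  · simp only [RootedMap.close, closeσ, Perm.mul_apply]
    rw [sw_map, sw_map]
    simp only [Equiv.sumCongr_apply, Sum.map_inl, Sum.map_inr, Equiv.refl_apply, hφ, h3]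
    rcases u with x | b <;> simp [h1]
  · rcases u with x | (_ | _) <;> simp [h2]

/-- The new darts are the root and its reverse, so they are preserved. The old root and the corner
at the other end are their successors around their vertices, hence preserved too, and undoing the
transpositions recovers the old rotation. -/
theorem Iso.of_close [Finite D] [Finite D'] {M : RootedMap D} {N : RootedMap D'}
    {h : M.φ (M.φ M.root) ≠ M.root} {h' : N.φ (N.φ N.root) ≠ N.root}
    (hMN : (M.close h).Iso (N.close h')) : M.Iso N := by
  obtain ⟨e, h1, h2, h3⟩ := hMN
  have ht : e (Sum.inr true) = Sum.inr true := h3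
  have hf : e (Sum.inr false) = Sum.inr false := by
    have := h2 (Sum.inr true)
    rwa [ht, close_α_true, close_α_true] at this
  have hr : ∀ b, e (Sum.inr b) = Sum.inr b := by rintro (_ | _) <;> assumption
  have hl : ∀ x, ∃ y, e (Sum.inl x) = Sum.inl y := by
    intro x
    rcases hx : e (Sum.inl x) with y | b
    · exact ⟨y, rfl⟩
    · rw [← hr b] at hx
      simp at hx
  obtain ⟨f, hf'⟩ := exists_equiv_inl e hl fun b => ⟨b, hr b⟩
  have hroot : f M.root = N.root := by
    have := h1 (Sum.inr true)
    rw [ht, close_σ_true, close_σ_true, hf'] at this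
    simpa using this
  have hw : f (M.φ (M.φ M.root)) = N.φ (N.φ N.root) := by
    have := h1 (Sum.inr false)
    rw [hf, close_σ_false, close_σ_false, hf'] at this
    simpa using this
  refine ⟨f, fun x => ?_, fun x => ?_, hroot⟩
  · have e1 := congrArg e (inl_eq_closeσ M.σ M.root (M.φ (M.φ M.root)) x)
    rw [sw_map, sw_map, hf, ht, hf', hf', hf', hroot, hw] at e1
    have e2 := inl_eq_closeσ N.σ N.root (N.φ (N.φ N.root)) (f x)
    have e3 := h1 (Sum.inl x)
    rw [hf'] at e3
    change e (closeσ _ _ _ _) = closeσ _ _ _ _ at e3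
    rw [e3, ← e2] at e1
    simpa using e1
  · have := h2 (Sum.inl x)
    rw [close_α_inl, hf', hf', close_α_inl] at this
    simpa using this

/-- A map of the class `T` whose root edge is not hanging is obtained by closing. -/
theorem exists_close_of_sum [Finite D] (N : RootedMap (D ⊕ Bool)) (hN : N.IsTD)
    (hr : N.root = Sum.inr true) (hα : N.α (Sum.inr true) = Sum.inr false)
    (hs : N.σ (Sum.inr false) ≠ Sum.inr false) :
    ∃ (M : RootedMap D) (h : M.φ (M.φ M.root) ≠ M.root), N.Iso (M.close h) := by
  have hα' : N.α (Sum.inr false) = Sum.inr true := by rw [← hα, N.α_invol]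
  have hφt : N.φ (Sum.inr true) = N.σ (Sum.inr false) := by rw [φ_apply, hα]
  have hφf : N.φ (Sum.inr false) = N.σ (Sum.inr true) := by rw [φ_apply, hα']
  -- The two sides of the root edge lie on different faces: otherwise a face would visit the end of
  -- the root at two corners. Hence the face on the left of the root is internal, so it is a
  -- triangle.
  have hnf : ¬ N.φ.SameCycle (Sum.inr true) (Sum.inr false) := by
    intro h
    apply hs
    refine hN.eq_of_sameCycle (sameCycle_apply_left.2 (SameCycle.refl _ _)) ?_
    rw [← hφt]
    exact sameCycle_apply_left.2 h
  have htri := hN.tri (Sum.inr false) (by rwa [hr])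
  obtain ⟨p, hp⟩ : ∃ p, N.σ (Sum.inr true) = Sum.inl p := by
    rcases h : N.σ (Sum.inr true) with x | (_ | _)
    · exact ⟨x, rfl⟩
    · exact absurd (hφf.trans h) (hN.φ_ne _)
    · exact absurd (SameCycle.symm ⟨1, by simpa using hφf.trans h⟩) hnf
  obtain ⟨w, hw⟩ : ∃ w, N.σ (Sum.inr false) = Sum.inl w := by
    rcases h : N.σ (Sum.inr false) with x | (_ | _)
    · exact ⟨x, rfl⟩
    · exact absurd h hs
    · exact absurd (hφt.trans h) (hN.φ_ne _)
  have hpw : p ≠ w := by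
    rintro rfl
    have := N.σ.injective (hp.trans hw.symm)
    simp at this
  obtain ⟨α, hαα⟩ : ∃ α, N.α = closeα α := by
    obtain ⟨α, g, hg⟩ := exists_sumCongr_of_mapsTo N.α fun x => by
      rcases h : N.α (Sum.inl x) with y | (_ | _)
      · exact ⟨y, rfl⟩
      · have := congrArg N.α h
        rw [N.α_invol, hα'] at this
        simp at this
      · have := congrArg N.α h
        rw [N.α_invol, hα] at this
        simp at this
    refine ⟨α, ?_⟩
    rw [hg, closeα]
    congr 1
    ext b
    rw [hg] at hα hα'
    cases b
    · simpa using hα'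
    · simpa using hα
  obtain ⟨σ, hσ⟩ : ∃ σ, N.σ = closeσ σ p w := by
    -- Undoing the two insertions leaves the new darts fixed, so that the rotation restricts to the
    -- old darts.
    set G := sw (Sum.inr false) (Sum.inl w) * (sw (Sum.inr true) (Sum.inl p) * N.σ) with hG
    have hGt : G (Sum.inr true) = Sum.inr true := by
      rw [hG, Perm.mul_apply, Perm.mul_apply, hp, sw_right, sw_of_ne (by simp) (by simp)]
    have hGf : G (Sum.inr false) = Sum.inr false := by
      rw [hG, Perm.mul_apply, Perm.mul_apply, hw, sw_of_ne (a := Sum.inr true) (by simp)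
        (by simpa using hpw.symm), sw_right]
    have hGr : ∀ b, G (Sum.inr b) = Sum.inr b := by rintro (_ | _) <;> assumption
    obtain ⟨σ, g, hg⟩ := exists_sumCongr_of_mapsTo G fun x => by
      rcases h : G (Sum.inl x) with y | b
      · exact ⟨y, rfl⟩
      · rw [← hGr b] at h
        simp at h
    have hg1 : g = 1 := by
      ext b
      have := hGr b
      rw [hg] at this
      simpa using this
    refine ⟨σ, ?_⟩
    rw [closeσ, ← hg1, ← hg, hG]
    simp
  -- The triangle on the left of the root consists of the reversed root and two old darts; this
  -- places `w` two steps after `p` on the face left by deleting the edge.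
  have hφw : σ (α (σ (α p))) = w := by
    rw [hφf, hp, φ_apply, φ_apply, hαα, hσ, closeα_inl] at htri
    rcases closeσ_inl_cases σ hpw (α p) with ⟨_, h2⟩ | ⟨_, h2⟩ | ⟨_, _, h2⟩
    · rw [h2, closeα_false, closeσ_true] at htri
      simp at htri
    · rw [h2, closeα_true, closeσ_false σ hpw] at htri
      simp at htri
    · rw [h2, closeα_inl] at htri
      rcases closeσ_inl_cases σ hpw (α (σ (α p))) with ⟨h3, _⟩ | ⟨_, h4⟩ | ⟨_, _, h4⟩
      · exact h3
      · rw [h4] at htri; simp at htri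
      · rw [h4] at htri; simp at htri
  have hc : (σ * α).SameCycle w p := by
    rw [← hφw]
    change (σ * α).SameCycle ((σ * α) ((σ * α) p)) p
    exact sameCycle_apply_left.2 (sameCycle_apply_left.2 (SameCycle.refl _ _))
  have hinv : ∀ x, α (α x) = x := fun x => by
    have := N.α_invol (Sum.inl x)
    rw [hαα] at this
    simpa using this
  let M : RootedMap D :=
    { σ := σ
      α := α
      root := p
      α_invol := hinv
      α_ne := fun x hx => N.α_ne (Sum.inl x) (by rw [hαα, closeα_inl, hx])
      connected := connected_of_conn fun x y S h1 h2 => by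
        refine N.conn_all (Sum.inl x) (Sum.inl y) (fun u => S (retract p w u)) ?_ ?_
        · rw [hσ]; exact closeσ_pred σ hpw S h1
        -- The deleted edge is bypassed along the other two sides of the triangle, so connectedness
        -- is kept.
        · have h3 : S p ↔ S w := by rw [← hφw, h1, h2, h1, h2]
          rw [hαα]
          rintro (x | (_ | _))
          · exact h2 x
          · exact h3
          · exact h3.symm
      euler := by
        have := N.euler_cyc
        rw [φ, hσ, hαα, cyc_closeσ, cyc_closeα, cyc_closeσ_mul_closeα σ α hc] at this
        change cyc σ + cyc (σ * α) = cyc α + 2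
        omega }
  have hMw : M.φ (M.φ M.root) = w := hφw
  refine ⟨M, by rw [hMw]; exact hpw.symm, Equiv.refl _, fun u => ?_, fun u => ?_, hr⟩
  · simp only [Equiv.refl_apply, close, hMw, hσ]
    rfl
  · simp only [Equiv.refl_apply, close, hαα]
    rfl

theorem exists_close [Finite D] (M : RootedMap D) (hM : M.IsTD)
    (hs : M.σ (M.α M.root) ≠ M.α M.root) :
    ∃ (D' : Type u) (_ : Finite D') (N : RootedMap D') (h : N.φ (N.φ N.root) ≠ N.root),
      M.Iso (N.close h) := by
  classical
  -- The two darts of the root edge are relabelled by `Bool`, which brings the map into the form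
  -- required by `exists_close_of_sum`.
  let f : {x // x ≠ M.root ∧ x ≠ M.α M.root} ⊕ Bool → D :=
    Sum.elim Subtype.val fun b => if b then M.root else M.α M.root
  have hf : Function.Bijective f := by
    have h0 := M.α_ne M.root
    constructor
    · rintro (⟨x, hx, hx'⟩ | (_ | _)) (⟨y, hy, hy'⟩ | (_ | _)) hxy <;>
        simp_all [f, eq_comm]
    · intro x
      by_cases h1 : x = M.root
      · exact ⟨Sum.inr true, by simp [f, h1]⟩
      · by_cases h2 : x = M.α M.root
        · exact ⟨Sum.inr false, by simp [f, h2]⟩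
        · exact ⟨Sum.inl ⟨x, h1, h2⟩, rfl⟩
  let e := (Equiv.ofBijective f hf).symm
  have het : e M.root = Sum.inr true := by rw [Equiv.symm_apply_eq]; rfl
  have hef : e (M.α M.root) = Sum.inr false := by rw [Equiv.symm_apply_eq]; rfl
  have het' : e.symm (Sum.inr true) = M.root := rfl
  have hef' : e.symm (Sum.inr false) = M.α M.root := rfl
  obtain ⟨N, h, hN⟩ := exists_close_of_sum (M.transport e) (hM.of_iso (M.iso_transport e)) het
    (by simp [transport, het', hef]) (by
      simp only [transport, Equiv.trans_apply, hef']
      rw [← hef]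
      exact e.injective.ne hs)
  exact ⟨_, inferInstance, N, h, (M.iso_transport e).trans hN⟩

end RootedMap

/-! ### Gluing two maps at a vertex -/

namespace MapEnum

open Equiv (Perm)
open Equiv.Perm

variable {D D' : Type*} [Finite D] [Finite D']

section

variable (f : Perm D) (g : Perm D') (a : D) (b : D')

theorem sameCycle_glue_inl_inl (x y : D) :
    (sw (Sum.inl a) (Sum.inr b) * sumCongr f g).SameCycle (Sum.inl x) (Sum.inl y) ↔
      f.SameCycle x y := by
  rw [sameCycle_sw_mul (not_sameCycle_inl_inr f g a b)]
  simp only [sameCycle_inl_inl, not_sameCycle_inr_inl, or_false]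
  exact ⟨fun h => h.elim id fun h => h.1.symm.trans h.2, Or.inl⟩

theorem sameCycle_glue_inr_inr (x y : D') :
    (sw (Sum.inl a) (Sum.inr b) * sumCongr f g).SameCycle (Sum.inr x) (Sum.inr y) ↔
      g.SameCycle x y := by
  rw [sameCycle_sw_mul (not_sameCycle_inl_inr f g a b)]
  simp only [sameCycle_inr_inr, not_sameCycle_inl_inr, false_or]
  exact ⟨fun h => h.elim id fun h => h.1.symm.trans h.2, Or.inl⟩

theorem sameCycle_glue_inl_inr (x : D) (y : D') :
    (sw (Sum.inl a) (Sum.inr b) * sumCongr f g).SameCycle (Sum.inl x) (Sum.inr y) ↔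
      f.SameCycle a x ∧ g.SameCycle b y := by
  rw [sameCycle_sw_mul (not_sameCycle_inl_inr f g a b)]
  simp only [sameCycle_inr_inr, sameCycle_inl_inl, not_sameCycle_inl_inr,
    not_sameCycle_inr_inl, false_or, or_false]

theorem sameCycle_glue_inr_inl (x : D) (y : D') :
    (sw (Sum.inl a) (Sum.inr b) * sumCongr f g).SameCycle (Sum.inr y) (Sum.inl x) ↔
      f.SameCycle a x ∧ g.SameCycle b y := by
  rw [sameCycle_comm, sameCycle_glue_inl_inr]

theorem cyc_glue : cyc f + cyc g = cyc (sw (Sum.inl a) (Sum.inr b) * sumCongr f g) + 1 := by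
  rw [← cyc_sumCongr, cyc_sw_mul_of_not_sameCycle (not_sameCycle_inl_inr f g a b)]

theorem glue_pred {S : D ⊕ D' → Prop}
    (hS : ∀ u, S ((sw (Sum.inl a) (Sum.inr b) * sumCongr f g) u) ↔ S u) :
    (S (Sum.inl a) ↔ S (Sum.inr b)) ∧ (∀ x, S (Sum.inl (f x)) ↔ S (Sum.inl x)) ∧
      (∀ x, S (Sum.inr (g x)) ↔ S (Sum.inr x)) := by
  have h1 : S (Sum.inl a) ↔ S (Sum.inr b) :=
    SameCycle.pred_iff hS ((sameCycle_glue_inl_inr f g a b a b).2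
      ⟨SameCycle.refl _ _, SameCycle.refl _ _⟩)
  have h2 : ∀ u, S (sumCongr f g u) ↔ S u := fun u => by
    rw [← hS u, Perm.mul_apply, sw_pred h1]
  exact ⟨h1, fun x => h2 (Sum.inl x), fun x => h2 (Sum.inr x)⟩

end

end MapEnum

namespace RootedMap

open Equiv (Perm)
open Equiv.Perm MapEnum

universe u

variable {D D' E E' : Type u} [Finite D] [Finite D'] [Finite E] [Finite E']

/-- Two maps glued by identifying the end of the root of the first with the origin of the root
of the second. -/
noncomputable def wedge (M : RootedMap D) (N : RootedMap D') : RootedMap (D ⊕ D') where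
  σ := sw (Sum.inl (M.φ M.root)) (Sum.inr N.root) * sumCongr M.σ N.σ
  α := sumCongr M.α N.α
  root := Sum.inl M.root
  α_invol := by rintro (x | x) <;> simp [M.α_invol, N.α_invol]
  α_ne := by rintro (x | x) <;> simp [M.α_ne, N.α_ne]
  connected := connected_of_conn fun u v S h1 h2 => by
    obtain ⟨h3, h4, h5⟩ := glue_pred _ _ _ _ h1
    have e1 := fun a b => M.conn_all a b (fun x => S (Sum.inl x)) h4 fun x => h2 (Sum.inl x)
    have e2 := fun a b => N.conn_all a b (fun x => S (Sum.inr x)) h5 fun x => h2 (Sum.inr x)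
    have e3 : ∀ u, S u ↔ S (Sum.inr N.root) := by
      rintro (x | x)
      · rw [← h3]; exact e1 _ _
      · exact e2 _ _
    rw [e3 u, e3 v]
  euler := by
    have hM := M.euler_cyc
    have hN := N.euler_cyc
    change cyc (sw _ _ * sumCongr _ _) + cyc (sw _ _ * sumCongr M.σ N.σ * sumCongr M.α N.α) =
      cyc (sumCongr _ _) + 2
    have h1 := cyc_glue M.σ N.σ (M.φ M.root) N.root
    have h2 := cyc_glue M.φ N.φ (M.φ M.root) N.root
    rw [cyc_sumCongr, mul_assoc, sumCongr_mul]
    change _ + cyc (sw _ _ * sumCongr M.φ N.φ) = _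
    omega

section Wedge

variable (M : RootedMap D) (N : RootedMap D')

/-- The transposition that joins two vertices stands on the left of the product, so the same formula
describes the faces: the two root-faces are merged, and no other face changes. -/
theorem wedge_φ : (M.wedge N).φ =
    sw (Sum.inl (M.φ M.root)) (Sum.inr N.root) * sumCongr M.φ N.φ := by
  change sw _ _ * sumCongr _ _ * sumCongr _ _ = _
  rw [mul_assoc, sumCongr_mul]
  rfl

@[simp] theorem wedge_root : (M.wedge N).root = Sum.inl M.root := rfl
@[simp] theorem wedge_α_inl (x : D) : (M.wedge N).α (Sum.inl x) = Sum.inl (M.α x) := rfl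
@[simp] theorem wedge_α_inr (x : D') : (M.wedge N).α (Sum.inr x) = Sum.inr (N.α x) := rfl

@[simp] theorem wedge_σ_inl_inl (x y : D) :
    (M.wedge N).σ.SameCycle (Sum.inl x) (Sum.inl y) ↔ M.σ.SameCycle x y :=
  sameCycle_glue_inl_inl _ _ _ _ _ _
@[simp] theorem wedge_σ_inr_inr (x y : D') :
    (M.wedge N).σ.SameCycle (Sum.inr x) (Sum.inr y) ↔ N.σ.SameCycle x y :=
  sameCycle_glue_inr_inr _ _ _ _ _ _
@[simp] theorem wedge_σ_inl_inr (x : D) (y : D') :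
    (M.wedge N).σ.SameCycle (Sum.inl x) (Sum.inr y) ↔
      M.σ.SameCycle (M.φ M.root) x ∧ N.σ.SameCycle N.root y :=
  sameCycle_glue_inl_inr _ _ _ _ _ _
@[simp] theorem wedge_σ_inr_inl (x : D) (y : D') :
    (M.wedge N).σ.SameCycle (Sum.inr y) (Sum.inl x) ↔
      M.σ.SameCycle (M.φ M.root) x ∧ N.σ.SameCycle N.root y :=
  sameCycle_glue_inr_inl _ _ _ _ _ _

@[simp] theorem wedge_φ_inl_inl (x y : D) :
    (M.wedge N).φ.SameCycle (Sum.inl x) (Sum.inl y) ↔ M.φ.SameCycle x y := by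
  rw [wedge_φ, sameCycle_glue_inl_inl]
@[simp] theorem wedge_φ_inr_inr (x y : D') :
    (M.wedge N).φ.SameCycle (Sum.inr x) (Sum.inr y) ↔ N.φ.SameCycle x y := by
  rw [wedge_φ, sameCycle_glue_inr_inr]
@[simp] theorem wedge_φ_inl_inr (x : D) (y : D') :
    (M.wedge N).φ.SameCycle (Sum.inl x) (Sum.inr y) ↔
      M.φ.SameCycle M.root x ∧ N.φ.SameCycle N.root y := by
  rw [wedge_φ, sameCycle_glue_inl_inr, sameCycle_apply_left]

theorem wedge_φ_root : (M.wedge N).φ (Sum.inl M.root) = Sum.inr N.root := by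
  rw [wedge_φ]; simp

theorem wedge_φ_inl {x : D} (hx : x ≠ M.root) :
    (M.wedge N).φ (Sum.inl x) = Sum.inl (M.φ x) := by
  rw [wedge_φ, Perm.mul_apply, sumCongr_apply, Sum.map_inl,
    sw_of_ne (by simpa using hx) (by simp)]

theorem wedge_φ_inr {x : D'} (hx : N.φ x ≠ N.root) :
    (M.wedge N).φ (Sum.inr x) = Sum.inr (N.φ x) := by
  rw [wedge_φ, Perm.mul_apply, sumCongr_apply, Sum.map_inr,
    sw_of_ne (by simp) (by simpa using hx)]

theorem wedge_σ_inl {x : D} (hx : M.σ x ≠ M.φ M.root) :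
    (M.wedge N).σ (Sum.inl x) = Sum.inl (M.σ x) := by
  change (sw (Sum.inl (M.φ M.root)) (Sum.inr N.root) * sumCongr M.σ N.σ) _ = _
  rw [Perm.mul_apply, sumCongr_apply, Sum.map_inl, sw_of_ne (by simpa using hx) (by simp)]

theorem wedge_σ_inl_of_eq {x : D} (hx : M.σ x = M.φ M.root) :
    (M.wedge N).σ (Sum.inl x) = Sum.inr N.root := by
  change (sw (Sum.inl (M.φ M.root)) (Sum.inr N.root) * sumCongr M.σ N.σ) _ = _
  rw [Perm.mul_apply, sumCongr_apply, Sum.map_inl, hx, sw_left]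

theorem wedge_σ_inr {x : D'} (hx : N.σ x ≠ N.root) :
    (M.wedge N).σ (Sum.inr x) = Sum.inr (N.σ x) := by
  change (sw (Sum.inl (M.φ M.root)) (Sum.inr N.root) * sumCongr M.σ N.σ) _ = _
  rw [Perm.mul_apply, sumCongr_apply, Sum.map_inr, sw_of_ne (by simp) (by simpa using hx)]

theorem wedge_closable (h : N.φ N.root ≠ N.root) :
    (M.wedge N).φ ((M.wedge N).φ (M.wedge N).root) ≠ (M.wedge N).root := by
  rw [wedge_root, wedge_φ_root, wedge_φ_inr _ _ h]
  simp

end Wedge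

theorem Iso.wedge {M : RootedMap D} {N : RootedMap D'} {P : RootedMap E} {Q : RootedMap E'}
    (hMP : M.Iso P) (hNQ : N.Iso Q) : (M.wedge N).Iso (P.wedge Q) := by
  obtain ⟨e, h1, h2, h3⟩ := hMP
  obtain ⟨f, g1, g2, g3⟩ := hNQ
  have hφ := map_φ h1 h2
  refine ⟨Equiv.sumCongr e f, fun u => ?_, fun u => ?_, ?_⟩
  · simp only [RootedMap.wedge, Perm.mul_apply]
    rw [sw_map]
    simp only [Equiv.sumCongr_apply, Sum.map_inl, Sum.map_inr, hφ, h3, g3]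
    rcases u with x | b <;> simp [h1, g1]
  · rcases u with x | x <;> simp [h2, g2]
  · simp [h3]

/-- The root and its successor on the root-face are preserved, that is, the roots of both parts. The
remaining gluing corner shares both vertex and face with the root of the second part, and in maps of
the class a face visits a vertex at most once, so this corner is preserved as well. The rotations
before gluing then correspond, and connectedness of each part makes the bijection respect the parts.
-/
theorem Iso.of_wedge {M : RootedMap D} {N : RootedMap D'} {P : RootedMap E} {Q : RootedMap E'}
    (hP : P.IsTD) (hQ : Q.IsTD) (h : (M.wedge N).Iso (P.wedge Q)) : M.Iso P ∧ N.Iso Q := by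
  obtain ⟨e, h1, h2, h3⟩ := h
  have hφ := map_φ h1 h2
  have hp : e (Sum.inl M.root) = Sum.inl P.root := h3
  have hq : e (Sum.inr N.root) = Sum.inr Q.root := by
    have := hφ (Sum.inl M.root)
    rwa [hp, wedge_φ_root, wedge_φ_root] at this
  have hs : e (Sum.inl (M.φ M.root)) = Sum.inl (P.φ P.root) := by
    have e1 : (M.wedge N).σ.SameCycle (Sum.inl (M.φ M.root)) (Sum.inr N.root) := by
      simp [SameCycle.refl]
    have e2 : (M.wedge N).φ.SameCycle (Sum.inl (M.φ M.root)) (Sum.inr N.root) := by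
      simp [SameCycle.refl]
    rw [sameCycle_map e h1, hq] at e1
    rw [sameCycle_map e hφ, hq] at e2
    rcases hz : e (Sum.inl (M.φ M.root)) with y | y
    · rw [hz, wedge_σ_inl_inr] at e1
      rw [hz, wedge_φ_inl_inr] at e2
      rw [hP.eq_of_sameCycle e1.1 (sameCycle_apply_left.2 e2.1)]
    · rw [hz, wedge_σ_inr_inr] at e1
      rw [hz, wedge_φ_inr_inr] at e2
      rw [hQ.eq_of_sameCycle e1 e2, ← hq] at hz
      simp at hz
  have hσ : ∀ u, e (sumCongr M.σ N.σ u) = sumCongr P.σ Q.σ (e u) := by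
    intro u
    have e1 : sumCongr M.σ N.σ u =
        sw (Sum.inl (M.φ M.root)) (Sum.inr N.root) ((M.wedge N).σ u) := (sw_sw _ _ _).symm
    have e2 : sumCongr P.σ Q.σ (e u) =
        sw (Sum.inl (P.φ P.root)) (Sum.inr Q.root) ((P.wedge Q).σ (e u)) := (sw_sw _ _ _).symm
    rw [e1, sw_map, hs, hq, h1, e2]
  have hl : ∀ x, ∃ y, e (Sum.inl x) = Sum.inl y := by
    intro x
    refine (M.conn_all M.root x (fun x => ∃ y, e (Sum.inl x) = Sum.inl y) (fun z => ?_)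
      (fun z => ?_)).1 ⟨_, hp⟩
    · have := hσ (Sum.inl z)
      rw [sumCongr_apply, Sum.map_inl] at this
      rw [this]
      rcases e (Sum.inl z) with y | y <;> simp
    · have := h2 (Sum.inl z)
      rw [wedge_α_inl] at this
      rw [this]
      rcases e (Sum.inl z) with y | y <;> simp
  have hr : ∀ x, ∃ y, e (Sum.inr x) = Sum.inr y := by
    intro x
    refine (N.conn_all N.root x (fun x => ∃ y, e (Sum.inr x) = Sum.inr y) (fun z => ?_)
      (fun z => ?_)).1 ⟨_, hq⟩
    · have := hσ (Sum.inr z)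
      rw [sumCongr_apply, Sum.map_inr] at this
      rw [this]
      rcases e (Sum.inr z) with y | y <;> simp
    · have := h2 (Sum.inr z)
      rw [wedge_α_inr] at this
      rw [this]
      rcases e (Sum.inr z) with y | y <;> simp
  obtain ⟨f, hf⟩ := exists_equiv_inl e hl hr
  obtain ⟨g, hg⟩ := exists_equiv_inr e hl hr
  constructor
  · refine ⟨f, fun x => ?_, fun x => ?_, ?_⟩
    · have := hσ (Sum.inl x)
      rw [hf, sumCongr_apply, sumCongr_apply, Sum.map_inl, hf] at this
      simpa using this
    · have := h2 (Sum.inl x)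
      rw [wedge_α_inl, hf, hf] at this
      simpa using this
    · rw [hf] at hp
      simpa using hp
  · refine ⟨g, fun x => ?_, fun x => ?_, ?_⟩
    · have := hσ (Sum.inr x)
      rw [hg, sumCongr_apply, sumCongr_apply, Sum.map_inr, hg] at this
      simpa using this
    · have := h2 (Sum.inr x)
      rw [wedge_α_inr, hg, hg] at this
      simpa using this
    · rw [hg] at hq
      simpa using hq

/-- A planar map whose root-face comes back to the end of the root is a wedge. -/
theorem exists_wedge (M : RootedMap D) {s : D} (hs : s ≠ M.φ M.root)
    (hσ : M.σ.SameCycle s (M.φ M.root)) (hφ : M.φ.SameCycle s (M.φ M.root)) :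
    ∃ (D₁ D₂ : Type u) (_ : Finite D₁) (_ : Finite D₂) (M₁ : RootedMap D₁) (M₂ : RootedMap D₂),
      M.Iso (M₁.wedge M₂) := by
  classical
  set q := M.φ M.root with hq
  -- Cutting the vertex at the corners `s` and `q`. The two parts are the component `P` of `s` and
  -- its complement, which is the component of `q`.
  set g := sw s q * M.σ with hg
  let P : D → Prop := fun x => conn g M.α s x
  have hPs : P s := (conn g M.α).refl s
  have hPq : ¬ P q := M.not_conn_cut hs hσ hφ
  have hPg : ∀ x, P (g x) ↔ P x := fun x => conn_left _ _ _ _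
  have hPα : ∀ x, P (M.α x) ↔ P x := fun x => conn_right _ _ _ _
  have hgα : g (M.α M.root) = s := by
    rw [hg, Perm.mul_apply, ← M.φ_apply, ← hq, sw_right]
  have hPp : P M.root := by rw [← hPα, ← hPg, hgα]
  let e : D ≃ {x // P x} ⊕ {x // ¬ P x} := (Equiv.sumCompl P).symm
  have hel : ∀ x (hx : P x), e x = Sum.inl ⟨x, hx⟩ := fun x hx => by
    rw [Equiv.symm_apply_eq]; rfl
  have her : ∀ x (hx : ¬ P x), e x = Sum.inr ⟨x, hx⟩ := fun x hx => by
    rw [Equiv.symm_apply_eq]; rfl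
  have hpres : ∀ f : Perm D, (∀ x, P (f x) ↔ P x) →
      ∃ f₁ f₂, ∀ x, e (f x) = sumCongr f₁ f₂ (e x) := by
    intro f hf
    obtain ⟨f₁, f₂, h12⟩ := exists_sumCongr_of_mapsTo ((e.symm.trans f).trans e) fun x =>
      ⟨⟨f x.1, (hf _).2 x.2⟩, hel _ _⟩
    refine ⟨f₁, f₂, fun x => ?_⟩
    rw [← h12]
    simp
  obtain ⟨σ₁, σ₂, hσ'⟩ := hpres g hPg
  obtain ⟨α₁, α₂, hα'⟩ := hpres M.α hPα
  have hσ₁ : ∀ x hx, Sum.inl (σ₁ ⟨x, hx⟩) = e (g x) := fun x hx => by rw [hσ', hel x hx]; rfl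
  have hσ₂ : ∀ x hx, Sum.inr (σ₂ ⟨x, hx⟩) = e (g x) := fun x hx => by rw [hσ', her x hx]; rfl
  have hα₁ : ∀ x hx, Sum.inl (α₁ ⟨x, hx⟩) = e (M.α x) := fun x hx => by rw [hα', hel x hx]; rfl
  have hα₂ : ∀ x hx, Sum.inr (α₂ ⟨x, hx⟩) = e (M.α x) := fun x hx => by rw [hα', her x hx]; rfl
  have inv : ∀ u, sumCongr α₁ α₂ (sumCongr α₁ α₂ u) = u := fun u => by
    obtain ⟨x, rfl⟩ := e.surjective u
    rw [← hα', ← hα', M.α_invol]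
  have ne : ∀ u, sumCongr α₁ α₂ u ≠ u := fun u => by
    obtain ⟨x, rfl⟩ := e.surjective u
    rw [← hα']
    exact e.injective.ne (M.α_ne x)
  have inv₁ : ∀ x, α₁ (α₁ x) = x := fun x => by simpa using inv (Sum.inl x)
  have inv₂ : ∀ x, α₂ (α₂ x) = x := fun x => by simpa using inv (Sum.inr x)
  have ne₁ : ∀ x, α₁ x ≠ x := fun x => by simpa using ne (Sum.inl x)
  have ne₂ : ∀ x, α₂ x ≠ x := fun x => by simpa using ne (Sum.inr x)
  have conn₁ : ∀ x y, conn σ₁ α₁ x y := by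
    rintro x y S h1 h2
    have := ((conn g M.α).trans ((conn g M.α).symm x.2) y.2)
      (fun z => Sum.elim S (fun _ => False) (e z)) (fun z => ?_) (fun z => ?_)
    · rwa [hel _ x.2, hel _ y.2] at this
    · rw [hσ']; rcases e z with z | z <;> simp [h1]
    · rw [hα']; rcases e z with z | z <;> simp [h2]
  have conn₂ : ∀ x y, conn σ₂ α₂ x y := by
    rintro x y S h1 h2
    have hx := (M.conn_cut s q x.1).resolve_left x.2
    have hy := (M.conn_cut s q y.1).resolve_left y.2
    have := ((conn g M.α).trans ((conn g M.α).symm hx) hy)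
      (fun z => Sum.elim (fun _ => False) S (e z)) (fun z => ?_) (fun z => ?_)
    · rwa [her _ x.2, her _ y.2] at this
    · rw [hσ']; rcases e z with z | z <;> simp [h1]
    · rw [hα']; rcases e z with z | z <;> simp [h2]
  have : Nonempty {x // P x} := ⟨⟨s, hPs⟩⟩
  have : Nonempty {x // ¬ P x} := ⟨⟨q, hPq⟩⟩
  -- The cut adds 2 to `V + F`, so the two parts together have `V + F = E + 4`. Each part satisfies
  -- `V + F ≤ E + 2` by `genus_bound`, so both are equalities.
  have euler : cyc σ₁ + cyc (σ₁ * α₁) = cyc α₁ + 2 ∧ cyc σ₂ + cyc (σ₂ * α₂) = cyc α₂ + 2 := by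
    have b1 := genus_bound σ₁ α₁
    have b2 := genus_bound σ₂ α₂
    rw [card_conn_eq_one conn₁, cyc_mul_comm] at b1
    rw [card_conn_eq_one conn₂, cyc_mul_comm α₂] at b2
    have c1 := two_mul_cyc_of_involutive inv₁ ne₁
    have c2 := two_mul_cyc_of_involutive inv₂ ne₂
    have d1 := cyc_map e hσ'
    have d2 := cyc_map e hα'
    have d3 := cyc_map (f := g * M.α) (g := sumCongr (σ₁ * α₁) (σ₂ * α₂)) e fun x => by
      rw [Perm.mul_apply, hσ', hα', ← sumCongr_mul]; rfl
    rw [cyc_sumCongr] at d1 d2 d3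
    have e1 := cyc_sw_mul_of_sameCycle hσ hs
    have e2 := cyc_sw_mul_of_sameCycle hφ hs
    have e3 : g * M.α = sw s q * M.φ := by rw [hg, mul_assoc]; rfl
    have e4 := M.euler_cyc
    rw [← hg] at e1
    rw [← e3] at e2
    omega
  let M₁ : RootedMap {x // P x} := ⟨σ₁, α₁, ⟨M.root, hPp⟩, inv₁, ne₁, connected_of_conn conn₁, euler.1⟩
  let M₂ : RootedMap {x // ¬ P x} := ⟨σ₂, α₂, ⟨q, hPq⟩, inv₂, ne₂, connected_of_conn conn₂, euler.2⟩
  -- In the first part, the successor of the root is `s` instead of `q`, so `s` is the corner at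
  -- which `wedge` glues.
  have hM₁ : M₁.φ M₁.root = ⟨s, hPs⟩ := by
    have h1 : α₁ ⟨M.root, hPp⟩ = ⟨M.α M.root, (hPα _).2 hPp⟩ := by
      have := hα₁ _ hPp
      rw [hel _ ((hPα _).2 hPp)] at this
      simpa using this
    have h2 := hσ₁ _ ((hPα _).2 hPp)
    rw [hgα, hel _ hPs, ← h1] at h2
    exact Sum.inl.inj h2
  refine ⟨_, _, inferInstance, inferInstance, M₁, M₂, e, fun x => ?_, hα', hel _ hPp⟩
  have h1 : M.σ x = sw s q (g x) := by rw [hg, Perm.mul_apply, sw_sw]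
  rw [h1, sw_map, hσ', hel s hPs, her q hPq, ← hM₁]
  rfl

end RootedMap

/-! ### The class `T` under closing and gluing -/

namespace RootedMap

open Equiv (Perm)
open Equiv.Perm MapEnum

universe u

variable {D D' : Type u}

theorem not_sameCycle_φ {M : RootedMap D} (hM : ∀ d, ¬ M.σ.SameCycle d (M.α d)) (d : D) :
    ¬ M.σ.SameCycle d (M.φ d) := by
  rw [φ_apply, sameCycle_apply_right]
  exact hM d

variable [Finite D] [Finite D']

section Close

variable (M : RootedMap D) (h : M.φ (M.φ M.root) ≠ M.root)

theorem close_φ_inl_of_not_sameCycle {x : D} (hx : ¬ M.φ.SameCycle M.root x) :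
    (M.close h).φ (Sum.inl x) = Sum.inl (M.φ x) := by
  rcases M.close_φ_inl_cases h x with ⟨h1, _⟩ | ⟨h1, _⟩ | ⟨_, _, h2⟩
  · exact absurd (by rw [h1]; exact sameCycle_apply_right.2 (SameCycle.refl _ _)) hx
  · exact absurd (by rw [← sameCycle_apply_right, h1]) hx
  · exact h2

theorem close_σ_inl {x : D} (h1 : ¬ M.σ.SameCycle x M.root)
    (h2 : ¬ M.σ.SameCycle x (M.φ (M.φ M.root))) :
    (M.close h).σ (Sum.inl x) = Sum.inl (M.σ x) :=
  closeσ_inl_of_ne M.σ (fun h' => h2 (by rw [← h', sameCycle_apply_right]))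
    (fun h' => h1 (by rw [← h', sameCycle_apply_right]))

theorem close_deg_iff {x : D} (h1 : ¬ M.σ.SameCycle x M.root)
    (h2 : ¬ M.σ.SameCycle x (M.φ (M.φ M.root))) :
    ((M.close h).σ (Sum.inl x) ≠ Sum.inl x ∧
      (M.close h).σ ((M.close h).σ (Sum.inl x)) ≠ Sum.inl x) ↔
    (M.σ x ≠ x ∧ M.σ (M.σ x) ≠ x) := by
  rw [M.close_σ_inl h h1 h2, M.close_σ_inl h (by rwa [sameCycle_apply_left])
    (by rwa [sameCycle_apply_left])]
  simp

/-- The new root replaces the first two darts of the old root-face, which pass to the new triangle.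
-/
theorem close_φ_root_iff (h' : M.φ M.root ≠ M.root) (u : D ⊕ Bool) :
    (M.close h).φ.SameCycle (Sum.inr true) u ↔ u = Sum.inr true ∨
      ∃ x, u = Sum.inl x ∧ M.φ.SameCycle M.root x ∧ x ≠ M.root ∧ x ≠ M.φ M.root := by
  constructor
  · intro hu
    refine SameCycle.pred_of_closed (S := fun u => u = Sum.inr true ∨
      ∃ x, u = Sum.inl x ∧ M.φ.SameCycle M.root x ∧ x ≠ M.root ∧ x ≠ M.φ M.root) ?_ hu (Or.inl rfl)
    rintro _ (rfl | ⟨x, rfl, h1, h2, h3⟩)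
    · rw [close_φ_true]
      refine Or.inr ⟨_, rfl, ?_, h, ?_⟩
      · simp [SameCycle.refl]
      · rwa [M.φ.injective.ne_iff]
    · rcases M.close_φ_inl_cases h x with ⟨h4, _⟩ | ⟨_, h5⟩ | ⟨_, h4, h5⟩
      · exact absurd h4 h3
      · exact Or.inl h5
      · refine Or.inr ⟨_, h5, by simpa using h1, h4, ?_⟩
        rwa [M.φ.injective.ne_iff]
  · have key : ∀ x, M.φ.SameCycle M.root x → (x = M.root ∨ x = M.φ M.root ∨
        (M.close h).φ.SameCycle (Sum.inr true) (Sum.inl x)) := by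
      intro x hx
      refine SameCycle.pred_of_closed (S := fun x => (x = M.root ∨ x = M.φ M.root ∨
        (M.close h).φ.SameCycle (Sum.inr true) (Sum.inl x))) ?_ hx (Or.inl rfl)
      rintro x (rfl | rfl | hx)
      · exact Or.inr (Or.inl rfl)
      · refine Or.inr (Or.inr ?_)
        rw [← close_φ_true M h, sameCycle_apply_right]
      · rcases M.close_φ_inl_cases h x with ⟨h4, _⟩ | ⟨h4, _⟩ | ⟨_, h4, h5⟩
        · subst h4
          refine Or.inr (Or.inr ?_)
          rw [← close_φ_true M h, sameCycle_apply_right]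
        · exact Or.inl h4
        · refine Or.inr (Or.inr ?_)
          rw [← h5, sameCycle_apply_right]
          exact hx
    rintro (rfl | ⟨x, rfl, h1, h2, h3⟩)
    · exact SameCycle.refl _ _
    · exact ((key x h1).resolve_left h2).resolve_left h3

/-- The part of `IsTD` about face degrees. -/
def Tri (M : RootedMap D) : Prop := ∀ d, ¬ M.φ.SameCycle M.root d → M.φ (M.φ (M.φ d)) = d

/-- Faces other than the old root-face are untouched, and the only new internal face is the triangle
formed by `Sum.inr false`, the old root and its successor. -/
theorem close_tri_iff (h' : M.φ M.root ≠ M.root) : (M.close h).Tri ↔ M.Tri := by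
  have key : ∀ x, ¬ M.φ.SameCycle M.root x →
      ((M.close h).φ ((M.close h).φ ((M.close h).φ (Sum.inl x))) = Sum.inl x ↔
        M.φ (M.φ (M.φ x)) = x) := by
    intro x hx
    rw [M.close_φ_inl_of_not_sameCycle h hx,
      M.close_φ_inl_of_not_sameCycle h (by rwa [sameCycle_apply_right]),
      M.close_φ_inl_of_not_sameCycle h (by rwa [sameCycle_apply_right, sameCycle_apply_right])]
    simp
  constructor
  · intro hT x hx
    refine (key x hx).1 (hT _ ?_)
    rw [close_root, M.close_φ_root_iff h h']
    rintro (h1 | ⟨y, h1, h2, _⟩)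
    · simp at h1
    · rw [Sum.inl.inj h1] at hx
      exact hx h2
  · intro hT u hu
    have e1 := M.close_φ_root h h'
    have e2 := M.close_φ_φ_root h
    rw [close_root, M.close_φ_root_iff h h'] at hu
    rcases u with x | (_ | _)
    · by_cases hx : M.φ.SameCycle M.root x
      · by_cases h1 : x = M.root
        · subst h1
          rw [e1, e2, close_φ_false]
        · by_cases h2 : x = M.φ M.root
          · subst h2
            rw [e2, close_φ_false, e1]
          · exact absurd (Or.inr ⟨x, rfl, hx, h1, h2⟩) hu
      · exact (key x hx).2 (hT x hx)
    · rw [close_φ_false, e1, e2]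
    · exact absurd (Or.inl rfl) hu

/-- Vertices of the closed map that are not on the root-face. -/
theorem exists_of_not_external (h' : M.φ M.root ≠ M.root) {d : D ⊕ Bool}
    (hd : ∀ y, (M.close h).φ.SameCycle (Sum.inr true) y → ¬ (M.close h).σ.SameCycle d y) :
    ∃ x, d = Sum.inl x ∧ ¬ M.σ.SameCycle x M.root ∧ ¬ M.σ.SameCycle x (M.φ (M.φ M.root)) ∧
      ∀ y, M.φ.SameCycle M.root y → y ≠ M.φ M.root → ¬ M.σ.SameCycle x y := by
  have ht := hd _ (SameCycle.refl _ _)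
  have hw := hd _ (show (M.close h).φ.SameCycle _ (Sum.inl (M.φ (M.φ M.root))) by
    rw [← close_φ_true M h, sameCycle_apply_right])
  rw [close_sameCycle_σ] at ht hw
  rcases d with x | (_ | _)
  · refine ⟨x, rfl, ht, hw, fun y hy hy' hxy => ?_⟩
    by_cases hyr : y = M.root
    · rw [hyr] at hxy; exact ht hxy
    · refine hd (Sum.inl y) ((M.close_φ_root_iff h h' _).2 (Or.inr ⟨y, rfl, hy, hyr, hy'⟩)) ?_
      rwa [close_sameCycle_σ]
  · exact absurd (SameCycle.refl _ _) hw
  · exact absurd (SameCycle.refl _ _) ht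

end Close

/-- Adding an edge cannot destroy nonseparability, and it makes no loop because the root-face meets
the origin of the root only once. -/
theorem IsTD.close {M : RootedMap D} (hM : M.IsTD) (h : M.φ (M.φ M.root) ≠ M.root)
    (hdeg : M.σ (M.σ (M.φ M.root)) ≠ M.φ M.root) : (M.close h).IsTD := by
  have h' := hM.φ_ne M.root
  have hpw : ¬ M.σ.SameCycle M.root (M.φ (M.φ M.root)) := fun h1 =>
    h (hM.eq_of_sameCycle h1 (by simp [SameCycle.refl])).symm
  refine ⟨?_, fun c S h1 h2 a b ha hb => ?_, (M.close_tri_iff h h').2 hM.tri, fun d hd => ?_⟩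
  · rintro (x | (_ | _)) <;> rw [close_sameCycle_σ]
    · exact hM.loopless x
    · exact fun h1 => hpw h1.symm
    · exact hpw
  · obtain ⟨h3, h4⟩ := closeσ_pred_inl M.σ h.symm S h1
    rw [close_sameCycle_σ] at ha hb
    rw [h4 a, h4 b]
    refine hM.nonsep _ (fun x => S (Sum.inl x)) h3 (fun x hx hx' => ?_) _ _ ha hb
    refine h2 (Sum.inl x) ?_ ?_ <;> rw [close_sameCycle_σ] <;> assumption
  · obtain ⟨x, rfl, hx1, hx2, hx3⟩ := M.exists_of_not_external h h' hd
    rw [close_deg_iff M h hx1 hx2]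
    -- The third vertex of the new triangle is the only one that may have become internal; `hdeg` is
    -- the degree condition for it.
    by_cases hxq : M.σ.SameCycle x (M.φ M.root)
    · have : M.σ (M.σ x) ≠ x := by
        rwa [Ne, SameCycle.pred_iff (S := fun z => M.σ (M.σ z) = z) (fun z => M.σ.injective.eq_iff)
          hxq]
      exact ⟨fun h1 => this (by rw [h1, h1]), this⟩
    · refine hM.deg x fun y hy => ?_
      by_cases hyq : y = M.φ M.root
      · rwa [hyq]
      · exact hx3 y hy hyq

/-- The point is nonseparability: after deleting a vertex `c`, the ends of the removed edge must
still be connected. They are joined through the third vertex of the triangle or, if that vertex is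
`c`, along the remaining root-face, which by `hint` avoids it. -/
theorem IsTD.of_close {M : RootedMap D} {h : M.φ (M.φ M.root) ≠ M.root}
    (hC : (M.close h).IsTD) (hint : ∀ y, (M.close h).φ.SameCycle (Sum.inr true) y →
      ¬ (M.close h).σ.SameCycle (Sum.inl (M.φ M.root)) y) :
    M.IsTD ∧ M.σ (M.σ (M.φ M.root)) ≠ M.φ M.root := by
  have hl : ∀ d, ¬ M.σ.SameCycle d (M.α d) := fun d => by
    have := hC.loopless (Sum.inl d)
    rwa [close_sameCycle_σ] at this
  have hl' := not_sameCycle_φ hl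
  have h' : M.φ M.root ≠ M.root := fun h1 => hl' M.root (by rw [h1])
  have h2 := hC.deg _ hint
  rw [close_deg_iff M h (fun h1 => hl' _ h1.symm) (hl' _)] at h2
  refine ⟨⟨hl, fun c S hS1 hS2 a b ha hb => ?_, (M.close_tri_iff h h').1 hC.tri, fun d hd => ?_⟩,
    h2.2⟩
  · set ρ := retract M.root (M.φ (M.φ M.root)) with hρ
    have hpw : ¬ M.σ.SameCycle c M.root → ¬ M.σ.SameCycle c (M.φ (M.φ M.root)) →
        (S (M.φ (M.φ M.root)) ↔ S M.root) := by
      intro hcp hcw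
      have step : ∀ x, ¬ M.σ.SameCycle c x → ¬ M.σ.SameCycle c (M.φ x) → (S (M.φ x) ↔ S x) := by
        intro x hx hx'
        rw [φ_apply, hS1]
        exact hS2 x hx (by rwa [φ_apply, sameCycle_apply_right] at hx')
      by_cases hcq : M.σ.SameCycle c (M.φ M.root)
      · have hface : ∀ x, (M.close h).φ.SameCycle (Sum.inr true) x → ¬ M.σ.SameCycle c (ρ x) := by
          intro x hx hcx
          apply hint x hx
          rw [close_sameCycle_σ]
          exact hcq.symm.trans hcx
        -- Here `c` is the third vertex of the triangle: the new root-face, without its root, is a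
        -- path between the two ends of the removed edge.
        have := pred_around_cycle (f := (M.close h).φ) (r := Sum.inr true) (S := fun u => S (ρ u))
          fun u hu hur => ?_
        · rw [close_φ_true] at this
          exact this
        · obtain ⟨x, rfl, _⟩ := ((M.close_φ_root_iff h h' u).1 hu).resolve_left hur
          have h3 := hface _ (sameCycle_apply_right.2 hu)
          have h4 : ρ ((M.close h).φ (Sum.inl x)) = M.φ x := retract_closeσ_inl M.σ h.symm (M.α x)
          rw [h4] at h3 ⊢
          exact step x (hface _ hu) h3
      · rw [step _ hcq hcw, step _ hcp hcq]
    have := hC.nonsep (Sum.inl c) (fun u => S (ρ u)) (closeσ_pred M.σ h.symm S hS1)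
      (fun u hu hu' => ?_) (Sum.inl a) (Sum.inl b)
      (by rwa [close_sameCycle_σ]) (by rwa [close_sameCycle_σ])
    · exact this
    · rw [close_sameCycle_σ] at hu hu'
      rcases u with x | (_ | _)
      · exact hS2 x hu hu'
      · exact (hpw hu' hu).symm
      · exact hpw hu hu'
  · rw [← close_deg_iff M h (fun h1 => hd _ (SameCycle.refl _ _) h1)
      (hd _ (by simp [SameCycle.refl]))]
    refine hC.deg _ fun u hu => ?_
    rw [close_sameCycle_σ]
    rcases (M.close_φ_root_iff h h' u).1 hu with rfl | ⟨x, rfl, h1, _⟩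
    · exact hd _ (SameCycle.refl _ _)
    · exact hd _ h1

section Wedge

variable {M : RootedMap D} {N : RootedMap D'}

theorem wedge_tri_iff : (M.wedge N).Tri ↔ M.Tri ∧ N.Tri := by
  have key₁ : ∀ x, ¬ M.φ.SameCycle M.root x → (M.wedge N).φ (Sum.inl x) = Sum.inl (M.φ x) :=
    fun x hx => wedge_φ_inl M N fun h1 => hx (by rw [h1])
  have key₂ : ∀ x, ¬ N.φ.SameCycle N.root x → (M.wedge N).φ (Sum.inr x) = Sum.inr (N.φ x) :=
    fun x hx => wedge_φ_inr M N fun h1 => hx (by rw [← sameCycle_apply_right, h1])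
  have key₃ : ∀ x, ¬ M.φ.SameCycle M.root x → ((M.wedge N).φ ((M.wedge N).φ ((M.wedge N).φ
      (Sum.inl x))) = Sum.inl x ↔ M.φ (M.φ (M.φ x)) = x) := by
    intro x hx
    rw [key₁ _ hx, key₁ _ (by rwa [sameCycle_apply_right]),
      key₁ _ (by rwa [sameCycle_apply_right, sameCycle_apply_right])]
    simp
  have key₄ : ∀ x, ¬ N.φ.SameCycle N.root x → ((M.wedge N).φ ((M.wedge N).φ ((M.wedge N).φ
      (Sum.inr x))) = Sum.inr x ↔ N.φ (N.φ (N.φ x)) = x) := by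
    intro x hx
    rw [key₂ _ hx, key₂ _ (by rwa [sameCycle_apply_right]),
      key₂ _ (by rwa [sameCycle_apply_right, sameCycle_apply_right])]
    simp
  constructor
  · intro h
    refine ⟨fun x hx => (key₃ x hx).1 (h _ ?_), fun x hx => (key₄ x hx).1 (h _ ?_)⟩
    · simpa using hx
    · simp [hx]
  · rintro ⟨h1, h2⟩ (x | x) hx
    · rw [wedge_root, wedge_φ_inl_inl] at hx
      exact (key₃ x hx).2 (h1 x hx)
    · rw [wedge_root, wedge_φ_inl_inr] at hx
      have hx' : ¬ N.φ.SameCycle N.root x := fun h' => hx ⟨SameCycle.refl _ _, h'⟩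
      exact (key₄ x hx').2 (h2 x hx')

theorem wedge_deg_inl {x : D} (hx : ¬ M.σ.SameCycle x (M.φ M.root)) :
    ((M.wedge N).σ (Sum.inl x) ≠ Sum.inl x ∧
      (M.wedge N).σ ((M.wedge N).σ (Sum.inl x)) ≠ Sum.inl x) ↔ (M.σ x ≠ x ∧ M.σ (M.σ x) ≠ x) := by
  have key : ∀ y, ¬ M.σ.SameCycle y (M.φ M.root) → (M.wedge N).σ (Sum.inl y) = Sum.inl (M.σ y) :=
    fun y hy => wedge_σ_inl M N fun h1 => hy (by rw [← h1, sameCycle_apply_right])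
  rw [key x hx, key _ (by rwa [sameCycle_apply_left])]
  simp

theorem wedge_deg_inr {x : D'} (hx : ¬ N.σ.SameCycle x N.root) :
    ((M.wedge N).σ (Sum.inr x) ≠ Sum.inr x ∧
      (M.wedge N).σ ((M.wedge N).σ (Sum.inr x)) ≠ Sum.inr x) ↔ (N.σ x ≠ x ∧ N.σ (N.σ x) ≠ x) := by
  have key : ∀ y, ¬ N.σ.SameCycle y N.root → (M.wedge N).σ (Sum.inr y) = Sum.inr (N.σ y) :=
    fun y hy => wedge_σ_inr M N fun h1 => hy (by rw [← h1, sameCycle_apply_right])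
  rw [key x hx, key _ (by rwa [sameCycle_apply_left])]
  simp

theorem wedge_φ_φ_root (hN : N.φ N.root ≠ N.root) :
    (M.wedge N).φ ((M.wedge N).φ (M.wedge N).root) = Sum.inr (N.φ N.root) := by
  rw [wedge_root, wedge_φ_root, wedge_φ_inr M N hN]

/-- The root-face visits the gluing vertex at two distinct corners. This is also what separates
joined maps from closed ones. -/
theorem wedge_not_isTD : ¬ (M.wedge N).IsTD := by
  intro h
  have := h.eq_of_sameCycle (a := Sum.inl (M.φ M.root)) (b := Sum.inr N.root)
    (by simp [SameCycle.refl]) (by simp [SameCycle.refl])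
  simp at this

theorem IsTD.close_wedge (hM : M.IsTD) (hN : N.IsTD)
    (h : (M.wedge N).φ ((M.wedge N).φ (M.wedge N).root) ≠ (M.wedge N).root) :
    ((M.wedge N).close h).IsTD := by
  have hMl := not_sameCycle_φ hM.loopless
  have hNl := not_sameCycle_φ hN.loopless
  have hw := wedge_φ_φ_root (M := M) (hN.φ_ne N.root)
  have h' : (M.wedge N).φ (M.wedge N).root ≠ (M.wedge N).root := by
    rw [wedge_root, wedge_φ_root]; simp
  have hpw : ¬ (M.wedge N).σ.SameCycle (Sum.inl M.root) (Sum.inr (N.φ N.root)) := by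
    rw [wedge_σ_inl_inr]
    exact fun h1 => hNl _ h1.2
  refine ⟨?_, fun c S hS1 hS2 a b ha hb => ?_,
    (close_tri_iff _ h h').2 (wedge_tri_iff.2 ⟨hM.tri, hN.tri⟩), fun d hd => ?_⟩
  · rintro (x | (_ | _)) <;> rw [close_sameCycle_σ]
    · rcases x with x | x
      · simpa using hM.loopless x
      · simpa using hN.loopless x
    · rw [close_α_false, retract_true, retract_false, hw]
      exact fun h1 => hpw h1.symm
    · rw [close_α_true, retract_true, retract_false, hw]
      exact hpw
  · obtain ⟨h3, h4⟩ := closeσ_pred_inl _ h.symm S hS1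
    obtain ⟨h5, h6, h7⟩ := glue_pred _ _ _ _ (S := fun x => S (Sum.inl x)) h3
    rw [close_sameCycle_σ] at ha hb
    rw [h4 a, h4 b]
    have hα : ∀ x, ¬ ((M.wedge N).close h).σ.SameCycle c (Sum.inl x) →
        ¬ ((M.wedge N).close h).σ.SameCycle c (Sum.inl ((M.wedge N).α x)) →
        (S (Sum.inl ((M.wedge N).α x)) ↔ S (Sum.inl x)) := fun x => hS2 (Sum.inl x)
    have ht := hS2 (Sum.inr true)
    rw [close_α_true, h4 (Sum.inr true), h4 (Sum.inr false)] at ht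
    simp only [close_sameCycle_σ] at hα ht
    generalize retract _ _ a = a at *
    generalize retract _ _ b = b at *
    generalize retract _ _ c = c at *
    rw [retract_false, retract_true, hw, wedge_root] at ht
    suffices hsuff : ∃ P : Prop, ∀ x, ¬ (M.wedge N).σ.SameCycle c x → (S (Sum.inl x) ↔ P) by
      obtain ⟨P, hP⟩ := hsuff
      rw [hP a ha, hP b hb]
    clear ha hb
    -- If the gluing vertex is deleted, what is left of each part is connected and the new edge
    -- links the two. If another vertex is deleted, the part containing it stays connected, the
    -- other part is intact, and they meet at the gluing vertex.
    by_cases hcv : (M.wedge N).σ.SameCycle c (Sum.inr N.root)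
    · have hv : ∀ x, (M.wedge N).σ.SameCycle c x ↔
          (M.wedge N).σ.SameCycle (Sum.inr N.root) x := fun x =>
        ⟨fun h1 => hcv.symm.trans h1, fun h1 => hcv.trans h1⟩
      simp only [hv] at hα ht ⊢
      have eM := hM.nonsep (M.φ M.root) (fun x => S (Sum.inl (Sum.inl x))) h6 fun x hx hx' =>
        hα (Sum.inl x) (by simp [hx]) (by simp [hx'])
      have eN := hN.nonsep N.root (fun x => S (Sum.inl (Sum.inr x))) h7 fun x hx hx' =>
        hα (Sum.inr x) (by simp [hx]) (by simp [hx'])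
      have hMl' : ¬ M.σ.SameCycle (M.φ M.root) M.root := fun h1 => hMl _ h1.symm
      have ht' := ht (by simp [hMl']) (by simpa using hNl N.root)
      refine ⟨S (Sum.inl (Sum.inl M.root)), ?_⟩
      rintro (x | x) hx
      · exact eM _ _ (by simpa [SameCycle.refl] using hx) hMl'
      · rw [← ht']
        exact eN _ _ (by simpa using hx) (hNl _)
    · refine ⟨S (Sum.inl (Sum.inr N.root)), ?_⟩
      rcases c with c | c
      · have hcs : ¬ M.σ.SameCycle (M.φ M.root) c := by
          simpa [SameCycle.refl] using hcv
        have hcs' : ¬ M.σ.SameCycle c (M.φ M.root) := fun h1 => hcs h1.symm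
        have eM := hM.nonsep c (fun x => S (Sum.inl (Sum.inl x))) h6 fun x hx hx' =>
          hα (Sum.inl x) (by simp [hx]) (by simp [hx'])
        rintro (x | x) hx
        · rw [← h5]
          exact eM _ _ (by simpa using hx) hcs'
        · exact N.conn_all x N.root (fun x => S (Sum.inl (Sum.inr x))) h7 fun x =>
            hα (Sum.inr x) (by simp [hcs]) (by simp [hcs])
      · have hcs' : ¬ N.σ.SameCycle c N.root := by simpa using hcv
        have hcs : ¬ N.σ.SameCycle N.root c := fun h1 => hcs' h1.symm
        have eN := hN.nonsep c (fun x => S (Sum.inl (Sum.inr x))) h7 fun x hx hx' =>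
          hα (Sum.inr x) (by simp [hx]) (by simp [hx'])
        rintro (x | x) hx
        · rw [← h5]
          exact M.conn_all x (M.φ M.root) (fun x => S (Sum.inl (Sum.inl x))) h6 fun x =>
            hα (Sum.inl x) (by simp [hcs]) (by simp [hcs])
        · exact eN _ _ (by simpa using hx) hcs'
  · obtain ⟨x, rfl, hx1, hx2, hx3⟩ := exists_of_not_external _ h h' hd
    rw [close_deg_iff _ h hx1 hx2]
    rw [wedge_root, wedge_φ_root] at hx3
    have hxs := hx3 (Sum.inl (M.φ M.root)) (by simp [SameCycle.refl]) (by simp)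
    rcases x with x | x
    · rw [wedge_σ_inl_inl] at hxs
      rw [wedge_deg_inl hxs]
      refine hM.deg x fun y hy => ?_
      have := hx3 (Sum.inl y) (by simpa using hy) (by simp)
      rwa [wedge_σ_inl_inl] at this
    · have hxs' : ¬ N.σ.SameCycle x N.root := by
        intro h1
        apply hxs
        simp [SameCycle.refl, h1.symm]
      rw [wedge_deg_inr hxs']
      refine hN.deg x fun y hy => ?_
      by_cases hyr : y = N.root
      · rwa [hyr]
      · have := hx3 (Sum.inr y) (by simp [SameCycle.refl, hy]) (by simpa using hyr)
        rwa [wedge_σ_inr_inr] at this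

theorem IsTD.of_close_wedge
    {h : (M.wedge N).φ ((M.wedge N).φ (M.wedge N).root) ≠ (M.wedge N).root}
    (hC : ((M.wedge N).close h).IsTD) : M.IsTD ∧ N.IsTD := by
  classical
  have hl : ∀ d, ¬ (M.wedge N).σ.SameCycle d ((M.wedge N).α d) := fun d => by
    have := hC.loopless (Sum.inl d)
    rwa [close_sameCycle_σ] at this
  have hM : ∀ d, ¬ M.σ.SameCycle d (M.α d) := fun d => by simpa using hl (Sum.inl d)
  have hN : ∀ d, ¬ N.σ.SameCycle d (N.α d) := fun d => by simpa using hl (Sum.inr d)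
  have hMl := not_sameCycle_φ hM
  have hNl := not_sameCycle_φ hN
  have hMl' : ¬ M.σ.SameCycle (M.φ M.root) M.root := fun h1 => hMl _ h1.symm
  have hNr : N.φ N.root ≠ N.root := fun h1 => hNl N.root (by rw [h1])
  have hw := wedge_φ_φ_root (M := M) hNr
  have h' : (M.wedge N).φ (M.wedge N).root ≠ (M.wedge N).root := by
    rw [wedge_root, wedge_φ_root]; simp
  have htri := wedge_tri_iff.1 ((close_tri_iff _ h h').1 hC.tri)
  -- Nonseparability of the closed map, restated for predicates on the wedge; the hypothesis on
  -- `M.root` and `N.φ N.root` accounts for the new edge.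
  have hns : ∀ (c : D ⊕ D') (S : D ⊕ D' → Prop), (S (Sum.inl (M.φ M.root)) ↔ S (Sum.inr N.root)) →
      (∀ x, S (Sum.inl (M.σ x)) ↔ S (Sum.inl x)) → (∀ x, S (Sum.inr (N.σ x)) ↔ S (Sum.inr x)) →
      (∀ x, ¬ (M.wedge N).σ.SameCycle c x → ¬ (M.wedge N).σ.SameCycle c ((M.wedge N).α x) →
        (S ((M.wedge N).α x) ↔ S x)) →
      (¬ (M.wedge N).σ.SameCycle c (Sum.inl M.root) →
        ¬ (M.wedge N).σ.SameCycle c (Sum.inr (N.φ N.root)) →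
        (S (Sum.inl M.root) ↔ S (Sum.inr (N.φ N.root)))) →
      ∀ a b, ¬ (M.wedge N).σ.SameCycle c a → ¬ (M.wedge N).σ.SameCycle c b → (S a ↔ S b) := by
    intro c S h1 h2 h3 h4 h5 a b ha hb
    refine hC.nonsep (Sum.inl c)
      (fun u => S (retract (M.wedge N).root ((M.wedge N).φ ((M.wedge N).φ (M.wedge N).root)) u))
      (closeσ_pred _ h.symm S ?_) (fun u hu hu' => ?_) (Sum.inl a) (Sum.inl b)
      (by rwa [close_sameCycle_σ]) (by rwa [close_sameCycle_σ])
    · intro x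
      change S ((sw (Sum.inl (M.φ M.root)) (Sum.inr N.root) * sumCongr M.σ N.σ) x) ↔ _
      rw [Perm.mul_apply, sw_pred h1]
      rcases x with x | x
      · exact h2 x
      · exact h3 x
    · rw [close_sameCycle_σ] at hu hu'
      rcases u with x | (_ | _)
      · exact h4 x hu hu'
      · rw [close_α_false, retract_true, retract_false, hw] at *
        exact h5 hu' hu
      · rw [close_α_true, retract_true, retract_false, hw] at *
        exact (h5 hu hu').symm
  -- The dart `N.root` leaves the root-face on closing, but its vertex remains external through the
  -- other corner at the gluing vertex.
  have hdeg : ∀ x, (∀ y, ¬ y = Sum.inr N.root → (M.wedge N).φ.SameCycle (M.wedge N).root y →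
      ¬ (M.wedge N).σ.SameCycle x y) →
      (M.wedge N).σ x ≠ x ∧ (M.wedge N).σ ((M.wedge N).σ x) ≠ x := by
    intro x hx
    rw [← close_deg_iff _ h]
    · refine hC.deg _ fun u hu => ?_
      rw [close_sameCycle_σ]
      rcases (close_φ_root_iff _ h h' u).1 hu with rfl | ⟨y, rfl, h1, h2, h3⟩
      · exact hx (Sum.inl M.root) (by simp) (SameCycle.refl _ _)
      · exact hx y (by rwa [wedge_root, wedge_φ_root] at h3) h1
    · exact hx _ (by simp) (SameCycle.refl _ _)
    · rw [hw]
      exact hx _ (by simpa using hNr) (by simp [SameCycle.refl])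
  refine ⟨⟨hM, fun c S hS1 hS2 a b ha hb => ?_, htri.1, fun d hd => ?_⟩,
    ⟨hN, fun c S hS1 hS2 a b ha hb => ?_, htri.2, fun d hd => ?_⟩⟩
  -- The predicate is extended to the second part by a constant, chosen so that it agrees across
  -- what joins the parts after deleting `c`: the gluing vertex or, if that is the deleted vertex,
  -- the new edge ending at `M.root`.
  · refine hns (Sum.inl c) (Sum.elim S fun y => if M.σ.SameCycle c (M.φ M.root) ∧
      ¬ N.σ.SameCycle N.root y then S M.root else S (M.φ M.root)) ?_ hS1 ?_ ?_ ?_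
      (Sum.inl a) (Sum.inl b) (by simpa using ha) (by simpa using hb)
    · simp [SameCycle.refl]
    · intro x; simp
    · rintro (x | x) hx hx'
      · exact hS2 x (by simpa using hx) (by simpa using hx')
      · by_cases hc : M.σ.SameCycle c (M.φ M.root)
        · rw [wedge_σ_inl_inr] at hx
          rw [wedge_α_inr, wedge_σ_inl_inr] at hx'
          have h1 : ¬ N.σ.SameCycle N.root x := fun h1 => hx ⟨hc.symm, h1⟩
          have h2 : ¬ N.σ.SameCycle N.root (N.α x) := fun h1 => hx' ⟨hc.symm, h1⟩
          simp [h1, h2]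
        · simp [hc]
    · intro hx hx'
      rw [wedge_σ_inl_inl] at hx
      by_cases hc : M.σ.SameCycle c (M.φ M.root)
      · simp [hc, hNl N.root]
      · simp only [Sum.elim_inl, Sum.elim_inr, hc, false_and, if_false]
        rw [φ_apply, hS1]
        rw [φ_apply, sameCycle_apply_right] at hc
        exact (hS2 _ hx hc).symm
  · rw [← wedge_deg_inl (N := N) (hd _ (by simp [SameCycle.refl]))]
    refine hdeg _ ?_
    rintro (y | y) hy1 hy2
    · simpa using hd y (by simpa using hy2)
    · rw [wedge_σ_inl_inr]
      exact fun h1 => hd _ (by simp [SameCycle.refl]) h1.1.symm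
  · refine hns (Sum.inr c) (Sum.elim (fun x => if N.σ.SameCycle c N.root ∧
      ¬ M.σ.SameCycle (M.φ M.root) x then S (N.φ N.root) else S N.root) S) ?_ ?_ hS1 ?_ ?_
      (Sum.inr a) (Sum.inr b) (by simpa using ha) (by simpa using hb)
    · simp [SameCycle.refl]
    · intro x; simp
    · rintro (x | x) hx hx'
      · by_cases hc : N.σ.SameCycle c N.root
        · rw [wedge_σ_inr_inl] at hx
          rw [wedge_α_inl, wedge_σ_inr_inl] at hx'
          have h1 : ¬ M.σ.SameCycle (M.φ M.root) x := fun h1 => hx ⟨h1, hc.symm⟩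
          have h2 : ¬ M.σ.SameCycle (M.φ M.root) (M.α x) := fun h1 => hx' ⟨h1, hc.symm⟩
          simp [h1, h2]
        · simp [hc]
      · exact hS2 x (by simpa using hx) (by simpa using hx')
    · intro hx hx'
      rw [wedge_σ_inr_inr] at hx'
      by_cases hc : N.σ.SameCycle c N.root
      · simp [hc, hMl']
      · simp only [Sum.elim_inl, Sum.elim_inr, hc, false_and, if_false]
        rw [φ_apply, hS1]
        rw [φ_apply, sameCycle_apply_right] at hx'
        exact (hS2 _ hc hx').symm
  · rw [← wedge_deg_inr (M := M) (hd _ (SameCycle.refl _ _))]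
    refine hdeg _ ?_
    rintro (y | y) hy1 hy2
    · rw [wedge_σ_inr_inl]
      exact fun h1 => hd _ (SameCycle.refl _ _) h1.2.symm
    · rw [wedge_root, wedge_φ_inl_inr] at hy2
      simpa using hd y hy2.2

end Wedge

end RootedMap

/-! ### Decomposition of the maps of the class `T` -/

namespace RootedMap

open Equiv (Perm)
open Equiv.Perm MapEnum

universe u

variable {D D' : Type u}

theorem single_isTD : single.IsTD where
  loopless d h := by
    have := sameCycle_one.1 h
    cases d <;> simp [single] at this
  nonsep c S _ _ a b ha hb := by
    have ha' : c ≠ a := fun h => ha (by rw [h])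
    have hb' : c ≠ b := fun h => hb (by rw [h])
    have : a = b := by cases a <;> cases b <;> cases c <;> simp_all
    rw [this]
  tri d hd := by
    exfalso
    apply hd
    cases d
    · exact ⟨1, rfl⟩
    · exact SameCycle.refl _ _
  deg d hd := by
    exfalso
    refine hd d ?_ (SameCycle.refl _ _)
    cases d
    · exact ⟨1, rfl⟩
    · exact SameCycle.refl _ _

theorem IsTD.iso_single {M : RootedMap D} (hM : M.IsTD) (h : M.σ M.root = M.root ∨
    M.σ (M.α M.root) = M.α M.root) : M.Iso single := by
  have hall : ∀ x, x = M.root ∨ x = M.α M.root := by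
    rcases h with h | h
    · exact hM.eq_of_fixed h
    · intro x
      have := hM.eq_of_fixed h x
      rwa [M.α_invol, or_comm] at this
  have hne := M.α_ne M.root
  have hσ : M.σ M.root = M.root ∧ M.σ (M.α M.root) = M.α M.root := by
    rcases h with h | h
    · refine ⟨h, (hall _).resolve_left fun h1 => hne ?_⟩
      exact M.σ.injective (h1.trans h.symm)
    · refine ⟨(hall _).resolve_right fun h1 => hne ?_, h⟩
      exact (M.σ.injective (h1.trans h.symm)).symm
  let f : Bool → D := fun b => if b then M.root else M.α M.root
  have hf : Function.Bijective f := by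
    constructor
    · rintro (_ | _) (_ | _) hxy
      · rfl
      · exact absurd hxy hne
      · exact absurd hxy.symm hne
      · rfl
    · intro x
      rcases hall x with rfl | rfl
      · exact ⟨true, rfl⟩
      · exact ⟨false, rfl⟩
  apply Iso.symm
  refine ⟨Equiv.ofBijective f hf, ?_, ?_, rfl⟩
  · rintro (_ | _)
    · exact hσ.2.symm
    · exact hσ.1.symm
  · rintro (_ | _)
    · exact (M.α_invol _).symm
    · rfl

/-- The end of the root has degree different from two. -/
def EndDegreeNeTwo (M : RootedMap D) : Prop := M.σ (M.σ (M.φ M.root)) ≠ M.φ M.root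

theorem Iso.endDegreeNeTwo_iff {M : RootedMap D} {N : RootedMap D'} (h : M.Iso N) :
    M.EndDegreeNeTwo ↔ N.EndDegreeNeTwo := by
  obtain ⟨e, h1, h2, h3⟩ := h
  have hφ := map_φ h1 h2
  rw [EndDegreeNeTwo, EndDegreeNeTwo, ← h3, ← hφ, ← h1, ← h1, e.injective.ne_iff]

theorem Iso.reroot_φ {M : RootedMap D} {N : RootedMap D'} (h : M.Iso N) :
    (M.reroot (M.φ M.root)).Iso (N.reroot (N.φ N.root)) := by
  obtain ⟨e, h1, h2, h3⟩ := h
  exact ⟨e, h1, h2, by rw [← h3]; exact map_φ h1 h2 _⟩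

theorem Iso.of_reroot_φ {M : RootedMap D} {N : RootedMap D'}
    (h : (M.reroot (M.φ M.root)).Iso (N.reroot (N.φ N.root))) : M.Iso N := by
  obtain ⟨e, h1, h2, h3⟩ := h
  refine ⟨e, h1, h2, N.φ.injective ?_⟩
  rw [← map_φ (M := M) (N := N) h1 h2]
  exact h3

/-- The degree of the root-face. -/
noncomputable def rootDegree (M : RootedMap D) : ℕ := Nat.card {y // M.φ.SameCycle M.root y}

theorem faceDegree_rootFace (M : RootedMap D) : M.faceDegree M.rootFace = M.rootDegree :=
  M.faceDegree_rightFace _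

theorem Iso.rootDegree_eq {M : RootedMap D} {N : RootedMap D'} (h : M.Iso N) :
    M.rootDegree = N.rootDegree := by
  obtain ⟨e, h1, h2, h3⟩ := h
  refine Nat.card_congr (e.subtypeEquiv fun y => ?_)
  rw [sameCycle_map e (map_φ h1 h2), h3]

theorem rootDegree_single : single.rootDegree = 2 := by
  have : ∀ y, single.φ.SameCycle single.root y := by
    rintro (_ | _)
    · exact ⟨1, rfl⟩
    · exact SameCycle.refl _ _
  rw [rootDegree, Nat.card_congr (Equiv.subtypeUnivEquiv this)]
  simp

theorem rootDegree_reroot_φ (M : RootedMap D) :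
    (M.reroot (M.φ M.root)).rootDegree = M.rootDegree :=
  Nat.card_congr (Equiv.subtypeEquivRight fun y => by
    change M.φ.SameCycle (M.φ M.root) y ↔ _
    rw [sameCycle_apply_left])

/-- The number of edges. -/
noncomputable def edges (M : RootedMap D) : ℕ := cyc M.α

theorem Iso.edges_eq {M : RootedMap D} {N : RootedMap D'} (h : M.Iso N) : M.edges = N.edges := by
  obtain ⟨e, _, h2, _⟩ := h
  exact cyc_map e h2

variable [Finite D] [Finite D']

theorem IsTD.two_le_rootDegree {M : RootedMap D} (hM : M.IsTD) : 2 ≤ M.rootDegree :=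
  two_le_card_sameCycle _ _ (hM.φ_ne _)

theorem IsTD.three_le_rootDegree_iff {M : RootedMap D} (hM : M.IsTD) :
    3 ≤ M.rootDegree ↔ M.φ (M.φ M.root) ≠ M.root := by
  rw [rootDegree, three_le_card_sameCycle_iff]
  exact ⟨fun h => h.2, fun h => ⟨hM.φ_ne _, h⟩⟩

theorem rootDegree_close (M : RootedMap D) (h : M.φ (M.φ M.root) ≠ M.root)
    (h' : M.φ M.root ≠ M.root) : (M.close h).rootDegree + 1 = M.rootDegree := by
  have e1 : {u | (M.close h).φ.SameCycle (Sum.inr true) u} =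
      insert (Sum.inr true) (Sum.inl '' ({x | M.φ.SameCycle M.root x} \ {M.root, M.φ M.root})) := by
    ext u
    rw [Set.mem_ofPred_eq, M.close_φ_root_iff h h']
    simp only [Set.mem_insert_iff, Set.mem_image, Set.mem_sdiff, Set.mem_ofPred_eq,
      Set.mem_singleton_iff, not_or]
    refine or_congr Iff.rfl (exists_congr fun x => ?_)
    rw [and_comm, eq_comm]
  have e2 : (M.close h).rootDegree = {u | (M.close h).φ.SameCycle (Sum.inr true) u}.ncard := rfl
  have e3 : M.rootDegree = {x | M.φ.SameCycle M.root x}.ncard := rfl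
  have hsub : ({M.root, M.φ M.root} : Set D) ⊆ {x | M.φ.SameCycle M.root x} := by
    rintro x (rfl | rfl)
    · exact SameCycle.refl _ _
    · exact sameCycle_apply_right.2 (SameCycle.refl _ _)
  have e4 := Set.ncard_sdiff_add_ncard_of_subset hsub
  rw [Set.ncard_pair h'.symm] at e4
  rw [e2, e3, e1, Set.ncard_insert_of_notMem (by simp),
    Set.ncard_image_of_injective _ Sum.inl_injective]
  omega

theorem rootDegree_wedge (M : RootedMap D) (N : RootedMap D') :
    (M.wedge N).rootDegree = M.rootDegree + N.rootDegree := by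
  unfold rootDegree
  rw [← Nat.card_sum]
  refine Nat.card_congr (Equiv.subtypeSum.trans (Equiv.sumCongr
    (Equiv.subtypeEquivRight fun x => ?_) (Equiv.subtypeEquivRight fun x => ?_)))
  · simp
  · simp [SameCycle.refl]

/-- Closing the wedge of two maps. -/
noncomputable def join (M : RootedMap D) (N : RootedMap D') (h : N.φ N.root ≠ N.root) :
    RootedMap ((D ⊕ D') ⊕ Bool) :=
  (M.wedge N).close (wedge_closable M N h)

theorem wedge_φ_root_ne (M : RootedMap D) (N : RootedMap D') :
    (M.wedge N).φ (M.wedge N).root ≠ (M.wedge N).root := by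
  rw [wedge_root, wedge_φ_root]; simp

theorem rootDegree_join (M : RootedMap D) (N : RootedMap D') (h : N.φ N.root ≠ N.root) :
    (M.join N h).rootDegree + 1 = M.rootDegree + N.rootDegree := by
  rw [join, rootDegree_close _ _ (wedge_φ_root_ne M N), rootDegree_wedge]

theorem edges_close (M : RootedMap D) (h : M.φ (M.φ M.root) ≠ M.root) :
    (M.close h).edges = M.edges + 1 := cyc_closeα M.α

theorem edges_join (M : RootedMap D) (N : RootedMap D') (h : N.φ N.root ≠ N.root) :
    (M.join N h).edges = M.edges + N.edges + 1 := by
  rw [join, edges_close]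
  exact congrArg (· + 1) (cyc_sumCongr M.α N.α)

theorem edges_single : single.edges = 1 := cyc_boolNot

theorem close_not_iso_single (M : RootedMap D) (h : M.φ (M.φ M.root) ≠ M.root) :
    ¬ (M.close h).Iso single := by
  rintro ⟨e, -⟩
  have := Nat.card_congr e
  have h0 : 0 < Nat.card D := Nat.card_pos_iff.2 ⟨⟨M.root⟩, inferInstance⟩
  rw [Nat.card_sum] at this
  omega

/-- Deleting the root edge of a map of the class `T`. -/
theorem IsTD.decompose {M : RootedMap D} (hM : M.IsTD) : M.Iso single ∨
    (∃ (E : Type u) (_ : Finite E) (N : RootedMap E) (h : N.φ (N.φ N.root) ≠ N.root),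
      M.Iso (N.close h) ∧ N.IsTD ∧ N.EndDegreeNeTwo) ∨
    ∃ (E F : Type u) (_ : Finite E) (_ : Finite F) (N : RootedMap E) (P : RootedMap F)
      (h : P.φ P.root ≠ P.root), M.Iso (N.join P h) ∧ N.IsTD ∧ P.IsTD := by
  by_cases hs : M.σ (M.α M.root) = M.α M.root
  · exact Or.inl (hM.iso_single (Or.inr hs))
  obtain ⟨E, _, N, h, hMN⟩ := M.exists_close hM hs
  have hC := hM.of_iso hMN
  refine Or.inr ?_
  have hl : ∀ d, ¬ N.σ.SameCycle d (N.α d) := fun d => by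
    have := hC.loopless (Sum.inl d)
    rwa [close_sameCycle_σ] at this
  have hl' := not_sameCycle_φ hl
  have h' : N.φ N.root ≠ N.root := fun h1 => hl' N.root (by rw [h1])
  -- Whether the third vertex of the triangle on the left of the root is internal.
  by_cases hint : ∀ y, (N.close h).φ.SameCycle (Sum.inr true) y →
      ¬ (N.close h).σ.SameCycle (Sum.inl (N.φ N.root)) y
  · obtain ⟨h1, h2⟩ := IsTD.of_close hC hint
    exact Or.inl ⟨E, inferInstance, N, h, hMN, h1, h2⟩
  · push Not at hint
    obtain ⟨y, hy1, hy2⟩ := hint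
    rw [close_sameCycle_σ] at hy2
    -- A second corner of the third vertex on the root-face of `N`, where `exists_wedge` can cut.
    obtain ⟨s, hs1, hs2, hs3⟩ : ∃ s, N.φ.SameCycle N.root s ∧ s ≠ N.φ N.root ∧
        N.σ.SameCycle (N.φ N.root) s := by
      rcases (N.close_φ_root_iff h h' y).1 hy1 with rfl | ⟨s, rfl, h1, _, h2⟩
      · exact absurd (SameCycle.symm hy2) (hl' _)
      · exact ⟨s, h1, h2, hy2⟩
    obtain ⟨A, B, _, _, P, Q, hPQ⟩ := N.exists_wedge hs2 hs3.symm
      (by rw [sameCycle_apply_right]; exact hs1.symm)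
    have hcl : (P.wedge Q).φ ((P.wedge Q).φ (P.wedge Q).root) ≠ (P.wedge Q).root := by
      obtain ⟨e, h1, h2, h3⟩ := hPQ
      rwa [← h3, ← map_φ h1 h2, ← map_φ h1 h2, e.injective.ne_iff]
    have hiso : M.Iso ((P.wedge Q).close hcl) := hMN.trans (hPQ.close h hcl)
    obtain ⟨hP, hQ⟩ := IsTD.of_close_wedge (hM.of_iso hiso)
    exact Or.inr ⟨A, B, inferInstance, inferInstance, P, Q, hQ.φ_ne _, hiso, hP, hQ⟩

theorem IsTD.join {M : RootedMap D} {N : RootedMap D'} (hM : M.IsTD) (hN : N.IsTD)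
    (h : N.φ N.root ≠ N.root) : (M.join N h).IsTD := hM.close_wedge hN _

theorem Iso.join {E E' : Type u} [Finite E] [Finite E'] {M : RootedMap D} {N : RootedMap D'}
    {P : RootedMap E} {Q : RootedMap E'} (hMP : M.Iso P) (hNQ : N.Iso Q)
    (h : N.φ N.root ≠ N.root) (h' : Q.φ Q.root ≠ Q.root) : (M.join N h).Iso (P.join Q h') :=
  (hMP.wedge hNQ).close _ _

theorem Iso.of_join {E E' : Type u} [Finite E] [Finite E'] {M : RootedMap D} {N : RootedMap D'}
    {P : RootedMap E} {Q : RootedMap E'} (hP : P.IsTD) (hQ : Q.IsTD)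
    {h : N.φ N.root ≠ N.root} {h' : Q.φ Q.root ≠ Q.root} (hi : (M.join N h).Iso (P.join Q h')) :
    M.Iso P ∧ N.Iso Q :=
  Iso.of_wedge hP hQ (Iso.of_close hi)

theorem IsTD.not_close_iso_join {E : Type u} [Finite E] {M : RootedMap D} {N : RootedMap D'}
    {P : RootedMap E} (hM : M.IsTD) (h : M.φ (M.φ M.root) ≠ M.root) (h' : P.φ P.root ≠ P.root) :
    ¬ (M.close h).Iso (N.join P h') :=
  fun hi => wedge_not_isTD (hM.of_iso (Iso.of_close hi))

end RootedMap

/-! ### Maps whose root starts at a vertex of degree two -/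

namespace RootedMap

open Equiv (Perm)
open Equiv.Perm MapEnum

variable {D : Type} [Finite D]

/-- A map of the class `T` whose root starts at a vertex of degree two and whose root-face is
not a digon comes from a smaller map. -/
theorem IsTD.exists_join_single {M : RootedMap D} (hM : M.IsTD)
    (hr : M.φ (M.φ M.root) ≠ M.root) (h2 : M.σ (M.σ M.root) = M.root) :
    ∃ (E : Type) (_ : Finite E) (N : RootedMap E) (h : N.φ N.root ≠ N.root),
      M.Iso (single.join N h) ∧ N.IsTD := by
  -- If the origin of the root has degree two, it has degree one once the root edge is deleted.
  have key : ∀ (E : Type) (_ : Finite E) (N : RootedMap E) (h : N.φ (N.φ N.root) ≠ N.root),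
      M.Iso (N.close h) → N.σ N.root = N.root := by
    rintro E _ N h ⟨e, h1, -, h3⟩
    have : (N.close h).σ ((N.close h).σ (N.close h).root) = (N.close h).root := by
      rw [← h3, ← h1, ← h1, h2]
    rw [close_root, close_σ_true] at this
    rcases closeσ_inl_cases N.σ h.symm N.root with ⟨_, h4⟩ | ⟨h4, _⟩ | ⟨_, _, h4⟩
    · have := h4.symm.trans this
      simp at this
    · exact h4
    · have := h4.symm.trans this
      simp at this
  rcases hM.decompose with h | ⟨E, _, N, h, hi, hN, _⟩ | ⟨E, F, _, _, N, P, h, hi, hN, hP⟩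
  · exfalso
    obtain ⟨e, h1, h2, h3⟩ := h
    apply hr
    apply e.injective
    rw [map_φ h1 h2, map_φ h1 h2, h3]
    rfl
  · exfalso
    -- A vertex of degree one makes `N` a single edge, whose root-face is a digon and cannot be
    -- closed.
    have hfix := key E _ N h hi
    have hall := hN.eq_of_fixed hfix
    have h5 : N.φ N.root = N.α N.root := (hall _).resolve_left (hN.φ_ne _)
    apply h
    rw [h5, φ_apply, N.α_invol, hfix]
  · have hfix := key _ _ _ _ hi
    have hN1 : N.σ N.root = N.root := by
      by_cases h6 : N.σ N.root = N.φ N.root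
      · rw [wedge_root, wedge_σ_inl_of_eq N P h6] at hfix
        simp at hfix
      · rw [wedge_root, wedge_σ_inl N P h6] at hfix
        exact Sum.inl.inj hfix
    have hNs := hN.iso_single (Or.inl hN1)
    exact ⟨F, inferInstance, P, h, hi.trans (hNs.join (Iso.refl P) h h), hP⟩

/-- Only the free end of the single edge and the new root meet at the origin of the root. -/
theorem σ_σ_root_join_single (N : RootedMap D) (h : N.φ N.root ≠ N.root) :
    (single.join N h).σ ((single.join N h).σ (single.join N h).root) =
      (single.join N h).root := by
  rw [join, close_root, close_σ_true]
  refine closeσ_inl_of_eq_left _ (wedge_closable single N h).symm ?_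
  exact wedge_σ_inl single N (x := true) (by simp [single, φ_apply])

/-- Every map of the class `T` arises in this way. -/
theorem IsTD.exists_reroot_iso {N : RootedMap D} (hN : N.IsTD) (h : N.φ N.root ≠ N.root) :
    ∃ (E : Type) (_ : Finite E) (M : RootedMap E), M.IsTD ∧ M.φ (M.φ M.root) ≠ M.root ∧
      ¬ M.EndDegreeNeTwo ∧ (M.reroot (M.φ M.root)).Iso (single.join N h) ∧
      M.rootDegree = N.rootDegree + 1 ∧ M.edges = N.edges + 2 := by
  set P := single.join N h with hP
  have hPT : P.IsTD := single_isTD.join hN h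
  -- The root is moved one step back along the root-face, so that it ends at the vertex of degree
  -- two.
  set M := P.reroot (P.φ.symm P.root) with hMdef
  have hroot : M.φ M.root = P.root := P.φ.apply_symm_apply P.root
  have hM : M.IsTD := hPT.reroot (by
    rw [← sameCycle_apply_right, P.φ.apply_symm_apply])
  have hre : M.reroot (M.φ M.root) = P := by rw [hroot]; rfl
  have hdeg : M.rootDegree = N.rootDegree + 1 := by
    have h1 := rootDegree_reroot_φ M
    have h2 := rootDegree_join single N h
    rw [hre] at h1
    rw [rootDegree_single, ← hP] at h2
    omega
  have hed : M.edges = N.edges + 2 := by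
    have h2 := edges_join single N h
    rw [edges_single, ← hP] at h2
    change P.edges = _
    omega
  refine ⟨_, inferInstance, M, hM, ?_, ?_, by rw [hre]; exact Iso.refl P, hdeg, hed⟩
  · rw [← hM.three_le_rootDegree_iff, hdeg]
    have := hN.two_le_rootDegree
    omega
  · rw [EndDegreeNeTwo, not_not, hroot]
    exact σ_σ_root_join_single N h

end RootedMap

/-! ### Isomorphism classes and their enumeration -/

open Equiv (Perm) in
instance RootedMap.finite {D : Type*} [Finite D] : Finite (RootedMap D) := by
  refine Finite.of_injective (β := Perm D × Perm D × D) (fun M => (M.σ, M.α, M.root)) ?_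
  rintro ⟨σ, α, r, _, _, _, _⟩ ⟨σ', α', r', _, _, _, _⟩ h
  simp only [Prod.mk.injEq] at h
  obtain ⟨rfl, rfl, rfl⟩ := h
  rfl

/-- A map of the class `T`, on any finite set of darts. -/
structure TMap : Type 1 where
  D : Type
  fin : Finite D
  M : RootedMap D
  isTD : M.IsTD

attribute [instance] TMap.fin

instance TMap.setoid : Setoid TMap where
  r A B := A.M.Iso B.M
  iseqv := ⟨fun A => RootedMap.Iso.refl A.M, fun h => h.symm, fun h h' => h.trans h'⟩

/-- Isomorphism classes of maps of the class `T`. -/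
def TClass : Type 1 := Quotient TMap.setoid

namespace TClass

open RootedMap

variable {D : Type} [Finite D]

/-- The class of a map. -/
def mk (M : RootedMap D) (hM : M.IsTD) : TClass := Quotient.mk TMap.setoid ⟨D, inferInstance, M, hM⟩

/-- A representative of a class. -/
noncomputable def rep (c : TClass) : TMap := Quotient.out (s := TMap.setoid) c

theorem mk_eq_iff {D' : Type} [Finite D'] {M : RootedMap D} {N : RootedMap D'} {hM : M.IsTD}
    {hN : N.IsTD} : mk M hM = mk N hN ↔ M.Iso N := Quotient.eq (r := TMap.setoid)

theorem mk_rep (c : TClass) : mk c.rep.M c.rep.isTD = c := Quotient.out_eq (s := TMap.setoid) c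

theorem iso_rep (M : RootedMap D) (hM : M.IsTD) : M.Iso (mk M hM).rep.M := by
  rw [← mk_eq_iff (hM := hM) (hN := (mk M hM).rep.isTD), mk_rep]

theorem rep_iso_iff {c d : TClass} : c.rep.M.Iso d.rep.M ↔ c = d := by
  rw [← mk_eq_iff (hM := c.rep.isTD) (hN := d.rep.isTD), mk_rep, mk_rep]

/-- The number of edges. -/
noncomputable def edges (c : TClass) : ℕ := c.rep.M.edges

/-- The degree of the root-face, minus two. -/
noncomputable def excess (c : TClass) : ℕ := c.rep.M.rootDegree - 2

theorem edges_mk (M : RootedMap D) (hM : M.IsTD) : (mk M hM).edges = M.edges :=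
  (iso_rep M hM).edges_eq.symm

theorem excess_add_two (c : TClass) : c.excess + 2 = c.rep.M.rootDegree :=
  Nat.sub_add_cancel c.rep.isTD.two_le_rootDegree

theorem excess_mk (M : RootedMap D) (hM : M.IsTD) : (mk M hM).excess + 2 = M.rootDegree := by
  rw [excess_add_two, ← (iso_rep M hM).rootDegree_eq]

theorem closable_rep {c : TClass} (hc : 0 < c.excess) :
    c.rep.M.φ (c.rep.M.φ c.rep.M.root) ≠ c.rep.M.root := by
  rw [← c.rep.isTD.three_le_rootDegree_iff, ← excess_add_two]
  omega

/-- The end of the root has degree different from two. -/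
def Good (c : TClass) : Prop := c.rep.M.EndDegreeNeTwo

/-- The class of the map with a single edge. -/
def singleClass : TClass := mk single single_isTD

/-- The class obtained by joining two maps by a new root edge. -/
noncomputable def join (a b : TClass) : TClass :=
  mk (a.rep.M.join b.rep.M (b.rep.isTD.φ_ne _)) (a.rep.isTD.join b.rep.isTD _)

/-- The class obtained by closing. -/
noncomputable def close (c : {c : TClass // 0 < c.excess ∧ c.Good}) : TClass :=
  mk (c.1.rep.M.close (closable_rep c.2.1)) (c.1.rep.isTD.close _ c.2.2)

theorem edges_single : singleClass.edges = 1 := by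
  rw [singleClass, edges_mk, RootedMap.edges_single]

theorem excess_single : singleClass.excess = 0 := by
  have := excess_mk single single_isTD
  rw [rootDegree_single] at this
  exact Nat.add_right_cancel this

theorem edges_join (a b : TClass) : (a.join b).edges = a.edges + b.edges + 1 := by
  rw [join, edges_mk, RootedMap.edges_join, edges, edges]

theorem excess_join (a b : TClass) : (a.join b).excess = a.excess + b.excess + 1 := by
  have h1 := excess_mk (a.rep.M.join b.rep.M (b.rep.isTD.φ_ne _)) (a.rep.isTD.join b.rep.isTD _)
  have h2 := rootDegree_join a.rep.M b.rep.M (b.rep.isTD.φ_ne _)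
  rw [← excess_add_two, ← excess_add_two] at h2
  rw [join]
  omega

theorem edges_close (c : {c : TClass // 0 < c.excess ∧ c.Good}) :
    (close c).edges = c.1.edges + 1 := by
  rw [close, edges_mk, RootedMap.edges_close, edges]

theorem excess_close (c : {c : TClass // 0 < c.excess ∧ c.Good}) :
    (close c).excess + 1 = c.1.excess := by
  have h1 := excess_mk (c.1.rep.M.close (closable_rep c.2.1)) (c.1.rep.isTD.close _ c.2.2)
  have h2 := rootDegree_close c.1.rep.M (closable_rep c.2.1) (c.1.rep.isTD.φ_ne _)
  rw [← excess_add_two] at h2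
  rw [close]
  omega

/-- The decomposition of the class `T`. -/
noncomputable def decomposition :
    Unit ⊕ (TClass × TClass) ⊕ {c : TClass // 0 < c.excess ∧ c.Good} → TClass :=
  Sum.elim (fun _ => singleClass) (Sum.elim (fun p => p.1.join p.2) close)

/-- The three kinds are disjoint: a closed map has more than two darts, and a wedge is never in the
class. Injectivity within a kind is `Iso.of_close` and `Iso.of_join`; surjectivity is
`IsTD.decompose`. -/
theorem decomposition_bijective : Function.Bijective decomposition := by
  constructor
  · rintro (_ | ⟨a, b⟩ | c) (_ | ⟨a', b'⟩ | c') h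
    · rfl
    · exact absurd (mk_eq_iff.1 h).symm (close_not_iso_single _ _)
    · exact absurd (mk_eq_iff.1 h).symm (close_not_iso_single _ _)
    · exact absurd (mk_eq_iff.1 h) (close_not_iso_single _ _)
    · obtain ⟨h1, h2⟩ := Iso.of_join a'.rep.isTD b'.rep.isTD (mk_eq_iff.1 h)
      obtain rfl : a = a' := rep_iso_iff.1 h1
      obtain rfl : b = b' := rep_iso_iff.1 h2
      rfl
    · exact absurd (mk_eq_iff.1 h).symm (c'.1.rep.isTD.not_close_iso_join _ _)
    · exact absurd (mk_eq_iff.1 h) (close_not_iso_single _ _)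
    · exact absurd (mk_eq_iff.1 h) (c.1.rep.isTD.not_close_iso_join _ _)
    · rw [Subtype.ext (rep_iso_iff.1 (Iso.of_close (mk_eq_iff.1 h)))]
  · intro c
    rcases c.rep.isTD.decompose with h | ⟨E, _, N, h, hi, hN, hd⟩ |
        ⟨E, F, _, _, N, P, h, hi, hN, hP⟩
    · refine ⟨Sum.inl (), ?_⟩
      rw [← mk_rep c]
      exact mk_eq_iff.2 h.symm
    · have hg : (mk N hN).Good := (iso_rep N hN).endDegreeNeTwo_iff.1 hd
      have he : 0 < (mk N hN).excess := by
        have := excess_mk N hN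
        have := hN.three_le_rootDegree_iff.2 h
        omega
      refine ⟨Sum.inr (Sum.inr ⟨mk N hN, he, hg⟩), ?_⟩
      rw [← mk_rep c]
      exact mk_eq_iff.2 (hi.trans ((iso_rep N hN).close _ _)).symm
    · refine ⟨Sum.inr (Sum.inl (mk N hN, mk P hP)), ?_⟩
      rw [← mk_rep c]
      exact mk_eq_iff.2 (hi.trans ((iso_rep N hN).join (iso_rep P hP) _ _)).symm

/-- Maps whose root ends at a vertex of degree two correspond to smaller maps. -/
theorem exists_equiv_not_good : ∃ e : TClass ≃ {c : TClass // 0 < c.excess ∧ ¬ c.Good},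
    ∀ c, (e c).1.edges = c.edges + 2 ∧ (e c).1.excess = c.excess + 1 := by
  have hex : ∀ c : TClass, ∃ d : {d : TClass // 0 < d.excess ∧ ¬ d.Good},
      (d.1.rep.M.reroot (d.1.rep.M.φ d.1.rep.M.root)).Iso
        (single.join c.rep.M (c.rep.isTD.φ_ne _)) ∧
      d.1.edges = c.edges + 2 ∧ d.1.excess = c.excess + 1 := by
    intro c
    obtain ⟨E, _, M, hM, h1, h2, h3, h4, h5⟩ := c.rep.isTD.exists_reroot_iso (c.rep.isTD.φ_ne _)
    have e1 := excess_mk M hM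
    have e2 := excess_add_two c
    refine ⟨⟨mk M hM, by omega, fun hg => h2 ((iso_rep M hM).endDegreeNeTwo_iff.2 hg)⟩,
      (iso_rep M hM).reroot_φ.symm.trans h3, ?_, ?_⟩
    · exact (edges_mk M hM).trans h5
    · change (mk M hM).excess = _
      omega
  choose f hf1 hf2 using hex
  refine ⟨Equiv.ofBijective f ⟨fun c c' h => ?_, fun d => ?_⟩, hf2⟩
  · have h1 := (hf1 c).symm
    rw [h] at h1
    have h2 := (Iso.of_join single_isTD c'.rep.isTD (h1.trans (hf1 c'))).2
    exact rep_iso_iff.1 h2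
  · obtain ⟨d, hd1, hd2⟩ := d
    -- After rerooting one step forward, the vertex of degree two is the origin of the root.
    have hT := d.rep.isTD.reroot (r := d.rep.M.φ d.rep.M.root)
      (Equiv.Perm.sameCycle_apply_right.2 (Equiv.Perm.SameCycle.refl _ _))
    have hr : 0 < (mk _ hT).excess := by
      have h1 := excess_mk _ hT
      have h2 := rootDegree_reroot_φ d.rep.M
      have h3 := excess_add_two d
      omega
    have hdeg : ¬ d.rep.M.EndDegreeNeTwo := hd2
    rw [EndDegreeNeTwo, not_not] at hdeg
    obtain ⟨E, _, N, h, hi, hN⟩ := hT.exists_join_single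
      (by rw [← hT.three_le_rootDegree_iff, ← excess_mk _ hT]; omega) hdeg
    refine ⟨mk N hN, Subtype.ext (rep_iso_iff.1 (Iso.of_reroot_φ ?_))⟩
    exact (hf1 (mk N hN)).trans
      (((Iso.refl single).join (iso_rep N hN) h _).symm.trans hi.symm)

theorem card_eq_two_mul_edges (M : RootedMap D) : Nat.card D = 2 * M.edges :=
  M.card_darts.symm

/-- The classes counted by `countT`. -/
noncomputable def fibreEquiv (n d : ℕ) :
    Quotient ((RootedMap.isoSetoid (Fin (2 * n))).comap
      (Subtype.val : {M : RootedMap (Fin (2 * n)) //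
        M.IsT ∧ M.faceDegree M.rootFace = d + 2} → RootedMap (Fin (2 * n)))) ≃
    {c : TClass // c.edges = n ∧ c.excess = d} := by
  have hedges : ∀ M : RootedMap (Fin (2 * n)), M.edges = n := fun M => by
    have := card_eq_two_mul_edges M
    rw [Nat.card_eq_fintype_card, Fintype.card_fin] at this
    omega
  refine Equiv.ofBijective (Quotient.lift (fun M => ⟨mk M.1 ((isT_iff _).1 M.2.1), ?_, ?_⟩) ?_)
    ⟨?_, ?_⟩
  · rw [edges_mk, hedges]
  · have h1 := excess_mk M.1 ((isT_iff _).1 M.2.1)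
    have h2 := M.2.2
    rw [faceDegree_rootFace] at h2
    omega
  · intro M N h
    exact Subtype.ext (mk_eq_iff.2 h)
  · intro a b h
    induction a using Quotient.inductionOn with | _ M
    induction b using Quotient.inductionOn with | _ N
    exact Quotient.sound (mk_eq_iff.1 (congrArg Subtype.val h))
  · rintro ⟨c, hc1, hc2⟩
    have hcard : Nat.card c.rep.D = 2 * n := by
      rw [card_eq_two_mul_edges c.rep.M]
      exact congrArg _ hc1
    -- A class on any set of darts has a representative on the standard set of the same size.
    let e : c.rep.D ≃ Fin (2 * n) := Finite.equivFinOfCardEq hcard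
    have hi := c.rep.M.iso_transport e
    have hT := c.rep.isTD.of_iso hi
    refine ⟨Quotient.mk _ ⟨c.rep.M.transport e, (isT_iff _).2 hT, ?_⟩, Subtype.ext ?_⟩
    · rw [faceDegree_rootFace, ← hi.rootDegree_eq, ← excess_add_two, hc2]
    · exact (mk_eq_iff.2 hi.symm).trans (mk_rep c)

theorem countT_eq (n d : ℕ) :
    countT n d = Nat.card {c : TClass // c.edges = n ∧ c.excess = d} :=
  Nat.card_congr (fibreEquiv n d)

instance finite_fibre (n d : ℕ) : Finite {c : TClass // c.edges = n ∧ c.excess = d} := by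
  have : Finite (Quotient ((RootedMap.isoSetoid (Fin (2 * n))).comap
      (Subtype.val : {M : RootedMap (Fin (2 * n)) //
        M.IsT ∧ M.faceDegree M.rootFace = d + 2} → RootedMap (Fin (2 * n))))) := inferInstance
  exact Finite.of_equiv _ (fibreEquiv n d)

/-- Pairs of classes with given total statistics. -/
noncomputable def pairEquiv (n d : ℕ) :
    {p : TClass × TClass // p.1.edges + p.2.edges = n ∧ p.1.excess + p.2.excess = d} ≃
    Σ q : (Finset.HasAntidiagonal.antidiagonal n ×ˢ Finset.HasAntidiagonal.antidiagonal d : Finset ((ℕ × ℕ) × (ℕ × ℕ))),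
      {c : TClass // c.edges = q.1.1.1 ∧ c.excess = q.1.2.1} ×
      {c : TClass // c.edges = q.1.1.2 ∧ c.excess = q.1.2.2} where
  toFun p := ⟨⟨((p.1.1.edges, p.1.2.edges), (p.1.1.excess, p.1.2.excess)), by
    simpa using p.2⟩, ⟨p.1.1, rfl, rfl⟩, ⟨p.1.2, rfl, rfl⟩⟩
  invFun s := ⟨(s.2.1.1, s.2.2.1), by
    obtain ⟨h1, h2⟩ := Finset.mem_product.1 s.1.2
    rw [s.2.1.2.1, s.2.1.2.2, s.2.2.2.1, s.2.2.2.2]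
    exact ⟨Finset.HasAntidiagonal.mem_antidiagonal.1 h1, Finset.HasAntidiagonal.mem_antidiagonal.1 h2⟩⟩
  left_inv p := rfl
  right_inv s := by
    obtain ⟨⟨⟨⟨i, j⟩, ⟨k, l⟩⟩, hq⟩, ⟨a, ha1, ha2⟩, ⟨b, hb1, hb2⟩⟩ := s
    dsimp only at ha1 ha2 hb1 hb2
    subst ha1 ha2 hb1 hb2
    rfl

theorem card_pairs (n d : ℕ) :
    Nat.card {p : TClass × TClass // p.1.edges + p.2.edges = n ∧ p.1.excess + p.2.excess = d} =
    ∑ i ∈ Finset.HasAntidiagonal.antidiagonal n, ∑ j ∈ Finset.HasAntidiagonal.antidiagonal d,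
      countT i.1 j.1 * countT i.2 j.2 := by
  rw [Nat.card_congr (pairEquiv n d), Nat.card_sigma]
  simp only [Nat.card_prod, ← countT_eq]
  rw [Finset.sum_coe_sort (Finset.HasAntidiagonal.antidiagonal n ×ˢ Finset.HasAntidiagonal.antidiagonal d)
    (fun q => countT q.1.1 q.2.1 * countT q.1.2 q.2.2), Finset.sum_product]

instance finite_pairs (n d : ℕ) : Finite {p : TClass × TClass //
    p.1.edges + p.2.edges = n ∧ p.1.excess + p.2.excess = d} :=
  Finite.of_equiv _ (pairEquiv n d).symm

/-- The maps that may not be closed are counted by `exists_equiv_not_good`. The equation is additive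
so as to avoid subtraction in `ℕ`. -/
theorem card_good (n d : ℕ) :
    Nat.card {c : {c : TClass // 0 < c.excess ∧ c.Good} // c.1.edges = n ∧ c.1.excess = d + 1} +
      Nat.card {c : TClass // c.edges + 2 = n ∧ c.excess = d} = countT n (d + 1) := by
  classical
  obtain ⟨e, he⟩ := exists_equiv_not_good
  rw [countT_eq]
  have e1 : {c : TClass // c.edges + 2 = n ∧ c.excess = d} ≃
      {c : {c : TClass // 0 < c.excess ∧ ¬ c.Good} // c.1.edges = n ∧ c.1.excess = d + 1} :=
    e.subtypeEquiv fun c => by rw [(he c).1, (he c).2, Nat.add_right_cancel_iff]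
  have e2 : ∀ Q : TClass → Prop, {c : {c : TClass // 0 < c.excess ∧ Q c} //
      c.1.edges = n ∧ c.1.excess = d + 1} ≃
      {c : {c : TClass // c.edges = n ∧ c.excess = d + 1} // Q c.1} := fun Q =>
    { toFun := fun c => ⟨⟨c.1.1, c.2⟩, c.1.2.2⟩
      invFun := fun c => ⟨⟨c.1.1, by rw [c.1.2.2]; exact Nat.succ_pos _, c.2⟩, c.1.2⟩
      left_inv := fun _ => rfl
      right_inv := fun _ => rfl }
  rw [Nat.card_congr e1, Nat.card_congr (e2 Good), Nat.card_congr (e2 fun c => ¬ c.Good),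
    ← Nat.card_sum]
  exact Nat.card_congr (Equiv.sumCompl fun c : {c : TClass // c.edges = n ∧ c.excess = d + 1} =>
    Good c.1)

/-- The recurrence that the decomposition gives. -/
theorem countT_rec (n d : ℕ) :
    countT (n + 1) d + Nat.card {c : TClass // c.edges + 2 = n ∧ c.excess = d} =
      (if n = 0 ∧ d = 0 then 1 else 0) +
      Nat.card {p : TClass × TClass //
        p.1.edges + p.2.edges = n ∧ p.1.excess + p.2.excess + 1 = d} + countT n (d + 1) := by
  rw [← card_good, countT_eq, Nat.card_congr (((Equiv.ofBijective _
    decomposition_bijective).subtypeEquiv (p := fun x => (decomposition x).edges = n + 1 ∧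
      (decomposition x).excess = d) fun _ => Iff.rfl).symm),
    Nat.card_congr (Equiv.subtypeSum.trans (Equiv.sumCongr (Equiv.refl _) Equiv.subtypeSum))]
  have e1 : {u : Unit // (decomposition (Sum.inl u)).edges = n + 1 ∧
      (decomposition (Sum.inl u)).excess = d} ≃ {u : Unit // n = 0 ∧ d = 0} :=
    Equiv.subtypeEquivRight fun u => by
      change singleClass.edges = _ ∧ singleClass.excess = _ ↔ _
      rw [edges_single, excess_single]
      omega
  have e2 : {p : TClass × TClass // (decomposition (Sum.inr (Sum.inl p))).edges = n + 1 ∧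
      (decomposition (Sum.inr (Sum.inl p))).excess = d} ≃ {p : TClass × TClass //
        p.1.edges + p.2.edges = n ∧ p.1.excess + p.2.excess + 1 = d} :=
    Equiv.subtypeEquivRight fun p => by
      change (p.1.join p.2).edges = _ ∧ (p.1.join p.2).excess = _ ↔ _
      rw [edges_join, excess_join]
      omega
  -- Closing lowers the excess by one, so excess `d` comes from excess `d + 1`.
  have e3 : {c : {c : TClass // 0 < c.excess ∧ c.Good} //
      (decomposition (Sum.inr (Sum.inr c))).edges = n + 1 ∧
      (decomposition (Sum.inr (Sum.inr c))).excess = d} ≃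
      {c : {c : TClass // 0 < c.excess ∧ c.Good} // c.1.edges = n ∧ c.1.excess = d + 1} :=
    Equiv.subtypeEquivRight fun c => by
      change (close c).edges = _ ∧ (close c).excess = _ ↔ _
      have := excess_close c
      rw [edges_close]
      omega
  have f2 : Finite {p : TClass × TClass //
      p.1.edges + p.2.edges = n ∧ p.1.excess + p.2.excess + 1 = d} := by
    -- For `d = 0` the source is empty, so the truncated `d - 1` is harmless.
    refine Finite.of_injective (β := {p : TClass × TClass //
      p.1.edges + p.2.edges = n ∧ p.1.excess + p.2.excess = d - 1})
      (fun p => ⟨p.1, p.2.1, by have := p.2.2; omega⟩) fun p q h => ?_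
    exact Subtype.ext (Subtype.mk.inj h)
  have f3 : Finite {c : {c : TClass // 0 < c.excess ∧ c.Good} //
      c.1.edges = n ∧ c.1.excess = d + 1} := by
    refine Finite.of_injective (β := {c : TClass // c.edges = n ∧ c.excess = d + 1})
      (fun c => ⟨c.1.1, c.2⟩) fun p q h => ?_
    exact Subtype.ext (Subtype.ext (Subtype.mk.inj h))
  rw [Nat.card_congr (Equiv.sumCongr e1 (Equiv.sumCongr e2 e3)), Nat.card_sum, Nat.card_sum]
  have e4 : Nat.card {u : Unit // n = 0 ∧ d = 0} = if n = 0 ∧ d = 0 then 1 else 0 := by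
    split_ifs with h <;> simp [h]
  rw [e4]
  ring

theorem one_le_edges (c : TClass) : 1 ≤ c.edges := by
  have h1 := card_eq_two_mul_edges c.rep.M
  have h2 : 0 < Nat.card c.rep.D := Nat.card_pos_iff.2 ⟨⟨c.rep.M.root⟩, inferInstance⟩
  change 1 ≤ c.rep.M.edges
  omega

theorem countT_zero (d : ℕ) : countT 0 d = 0 := by
  rw [countT_eq, Nat.card_eq_zero]
  exact Or.inl ⟨fun c => by have := one_le_edges c.1; have := c.2.1; omega⟩

theorem card_shift (n d : ℕ) : Nat.card {c : TClass // c.edges + 2 = n ∧ c.excess = d} =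
    if 2 ≤ n then countT (n - 2) d else 0 := by
  split_ifs with h
  · rw [countT_eq]
    exact Nat.card_congr (Equiv.subtypeEquivRight fun c => by omega)
  · rw [Nat.card_eq_zero]
    exact Or.inl ⟨fun c => by have := c.2.1; omega⟩

theorem card_pairs_shift (n d : ℕ) : Nat.card {p : TClass × TClass //
      p.1.edges + p.2.edges = n ∧ p.1.excess + p.2.excess + 1 = d} =
    if d = 0 then 0 else ∑ i ∈ Finset.HasAntidiagonal.antidiagonal n, ∑ j ∈ Finset.HasAntidiagonal.antidiagonal (d - 1),
      countT i.1 j.1 * countT i.2 j.2 := by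
  split_ifs with h
  · rw [Nat.card_eq_zero]
    exact Or.inl ⟨fun c => by have := c.2.2; omega⟩
  · rw [← card_pairs]
    exact Nat.card_congr (Equiv.subtypeEquivRight fun c => by omega)

end TClass

/-! ### From the recurrence to the functional equation -/

/-- `(T(x) - T(0)) / x`. -/
noncomputable def quotientSeriesT : PowerSeries (Polynomial ℤ) :=
  PowerSeries.mk fun n => (PowerSeries.coeff n seriesT).divX

theorem coeff_quotientSeriesT (n d : ℕ) :
    (PowerSeries.coeff n quotientSeriesT).coeff d = (countT n (d + 1) : ℤ) := by
  rw [quotientSeriesT, PowerSeries.coeff_mk, Polynomial.coeff_divX, coeff_coeff_seriesT]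

theorem mul_quotientSeriesT :
    PowerSeries.C Polynomial.X * quotientSeriesT = seriesT - atZero seriesT := by
  ext n d
  rw [PowerSeries.coeff_C_mul, map_sub, Polynomial.coeff_sub, atZero, PowerSeries.coeff_mk,
    coeff_coeff_seriesT]
  cases d with
  | zero => simp [← Polynomial.coeff_zero_eq_eval_zero, coeff_coeff_seriesT]
  | succ d =>
    rw [Polynomial.coeff_X_mul, coeff_quotientSeriesT, Polynomial.coeff_C_succ, sub_zero]

theorem coeff_seriesT_sq (n d : ℕ) : (PowerSeries.coeff n (seriesT ^ 2)).coeff d =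
    ((∑ i ∈ Finset.HasAntidiagonal.antidiagonal n, ∑ j ∈ Finset.HasAntidiagonal.antidiagonal d,
      countT i.1 j.1 * countT i.2 j.2 : ℕ) : ℤ) := by
  rw [sq, PowerSeries.coeff_mul, Polynomial.finsetSum_coeff]
  push_cast
  refine Finset.sum_congr rfl fun i _ => ?_
  rw [Polynomial.coeff_mul]
  simp only [coeff_coeff_seriesT]

theorem seriesT_eq : seriesT = PowerSeries.X +
    PowerSeries.X * (PowerSeries.C Polynomial.X * seriesT ^ 2) +
    PowerSeries.X * quotientSeriesT - PowerSeries.X ^ 3 * seriesT := by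
  ext n d
  simp only [map_sub, map_add, Polynomial.coeff_sub, Polynomial.coeff_add, coeff_coeff_seriesT]
  cases n with
  | zero => simp [TClass.countT_zero, PowerSeries.coeff_X_pow_mul', PowerSeries.coeff_zero_X_mul]
  | succ n =>
    have h := TClass.countT_rec n d
    rw [TClass.card_shift, TClass.card_pairs_shift] at h
    rw [PowerSeries.coeff_succ_X_mul, PowerSeries.coeff_succ_X_mul, coeff_quotientSeriesT,
      PowerSeries.coeff_C_mul, PowerSeries.coeff_X_pow_mul']
    have h1 : (PowerSeries.coeff (n + 1) (PowerSeries.X : PowerSeries (Polynomial ℤ))).coeff d =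
        ((if n = 0 ∧ d = 0 then 1 else 0 : ℕ) : ℤ) := by
      rw [PowerSeries.coeff_X]
      by_cases hn : n = 0 <;> simp [hn, Polynomial.coeff_one]
    -- The coefficient is taken at `n + 1`, so the factor `z ^ 3` shifts to `n - 2`, in agreement
    -- with the two additional edges in `card_shift`.
    have h2 : (if 3 ≤ n + 1 then PowerSeries.coeff (n + 1 - 3) seriesT else 0).coeff d =
        ((if 2 ≤ n then countT (n - 2) d else 0 : ℕ) : ℤ) := by
      by_cases hn : 2 ≤ n
      · rw [if_pos (by omega), if_pos hn, coeff_coeff_seriesT]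
        rfl
      · rw [if_neg (by omega), if_neg hn]
        simp
    have h3 : ((Polynomial.X : Polynomial ℤ) * PowerSeries.coeff n (seriesT ^ 2)).coeff d =
        ((if d = 0 then 0 else ∑ i ∈ Finset.HasAntidiagonal.antidiagonal n, ∑ j ∈ Finset.HasAntidiagonal.antidiagonal (d - 1),
          countT i.1 j.1 * countT i.2 j.2 : ℕ) : ℤ) := by
      cases d with
      | zero => simp
      | succ d => rw [Polynomial.coeff_X_mul, coeff_seriesT_sq]; simp
    rw [h1, h2, h3]
    omega

/-- The quotient by `x` enters through its defining equation, which determines `Q` because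
multiplication by `x` is injective. -/
theorem mainTheorem9 :
    let x : PowerSeries (Polynomial ℤ) := PowerSeries.C Polynomial.X
    let z : PowerSeries (Polynomial ℤ) := PowerSeries.X
    let T : PowerSeries (Polynomial ℤ) := seriesT
    ∃ Q : PowerSeries (Polynomial ℤ),
      x * Q = T - atZero T ∧ T = z + x * z * T ^ 2 + z * Q - z ^ 3 * T := by
  intro x z T
  refine ⟨quotientSeriesT, mul_quotientSeriesT, ?_⟩
  have h := seriesT_eq
  rw [mul_left_comm, ← mul_assoc] at h
  exact h
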